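/- **Definitions.** A 4-valent virtual graph is a finite graph immersed in the plane, every vertex having four half-edges in a cyclic (counterclockwise) order, whose edges may also cross transversely at virtual double points, which are not vertices; loops, multiple edges, several connected components and components that are closed curves without a vertex are allowed. A *checkerboard-colorable vertex-signed 2-digraph* $G$ is such a graph with a sign $+$ or $-$ at every vertex and a direction of every edge such that, around every vertex, incoming and outgoing half-edges alternate (a source-target structure); the associated checkerboard coloring colors the left side of every directed edge. At a vertex $v$ there are two *mergings*, each joining every incoming edge to one of the two neighbouring outgoing edges and deleting $v$: the *internal* merging, after which a marker connecting the two strands across the place of $v$ lies in the colored region, and the *external* merging, after which it lies in the uncolored region. Let $G_0^v$ and $G_1^v$ be the 2-digraphs obtained from $G$ by the internal and the external merging at $v$, respectively, with the inherited directions, coloring and signs. Let $G$ be connected with vertices $v_1,\dots,v_n$, and let $\gamma$ be an Euler circuit of $G$ (a directed closed path, up to its starting point, traversing each edge exactly once, hence visiting each vertex twice). Two distinct vertices $v_i,v_j$ *interlace* in $\gamma$ if $\gamma$ visits them alternately, $\ldots v_i\ldots v_j\ldots v_i\ldots v_j\ldots$. The vertex $v_i$ is *live* if every $v_j$ interlacing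 with it has $j>i$, and *dead* otherwise; it is *internal* or *external* to $\gamma$ according to which merging is performed by the two passages of $\gamma$ through $v_i$. The weight $\mu_i(\gamma)$ is given by | | live, internal | dead, internal | live, external | dead, external | |---|---|---|---|---| | $v_i$ positive | $-q^{-3}$ | $q$ | $-q^{3}$ | $q^{-1}$ | | $v_i$ negative | $-q^{3}$ | $q^{-1}$ | $-q^{-3}$ | $q$ | and $X_G(q)=\sum_{\gamma}\prod_{i=1}^n\mu_i(\gamma)\in\mathbb Z[q,q^{-1}]$, the sum being over all Euler circuits $\gamma$ of $G$; for a single closed curve without vertices, $X_G=1$. If $G$ has connected components $G_1,\dots,G_m$, $m\ge 1$, then $X_G=(-(q^2+q^{-2}))^{m-1}\prod_{i=1}^m X_{G_i}$. **Theorem.** Let $G$ be a checkerboard-colorable vertex-signed 2-digraph and let $v$ be a vertex of $G$. For every choice of labelings of the vertices of $G$, of $G_0^v$ and of $G_1^v$ (chosen independently of each other), the following holds. 1. If $v$ is positive, then $X_G(q)=q\,X_{G_0^v}(q)+q^{-1}X_{G_1^v}(q)$. 2. If $v$ is negative, then $X_G(q)=q^{-1}X_{G_0^v}(q)+q\,X_{G_1^v}(q)$.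 -/

import Mathlib

open scoped LaurentPolynomial

/-- The two signs a vertex can carry. -/
inductive VertexSign
  | plus
  | minus

/-- The two ways of merging the edges at a vertex of a checkerboard-coloured 2-digraph, each edge
coming in being joined to one of the two neighbouring edges going out. The marker, which connects
the two strands across the deleted vertex, lies in the coloured region for the `internal` merging
and in the uncoloured region for the `external` one. -/
inductive Merging
  | internal
  | external

/-- A vertex-signed checkerboard-coloured 2-digraph with vertex set `V`, possibly disconnected and
possibly with closed curves that carry no vertex.

A 4-valent virtual graph is recorded by its half-edges: `(v, i)`, for `i : ZMod 4`, are the four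
half-edges at `v` in counterclockwise order, and `opp` exchanges the two ends of each edge (so loops
and multiple edges are allowed). Virtual double points carry no data. `circles` is the number of
components without a vertex.

`out h` says that the edge of `h` is directed away from the vertex at `h`. The directions form a
source-target structure: they alternate around each vertex (so that two opposite half-edges come in
and the other two go out). The checkerboard colouring is the one associated with this structure: the
coloured side of every edge is the left one. So the corner at `v` between `(v, i)` and `(v, i + 1)`
is coloured exactly if `(v, i)` goes out, and every checkerboard colouring of the underlying
4-valent virtual graph arises in this way from exactly one source-target structure. -/
structure CheckerboardDigraph (V : Type*) where
  opp : V × ZMod 4 → V × ZMod 4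
  opp_opp : ∀ h, opp (opp h) = h
  opp_ne : ∀ h, opp h ≠ h
  circles : ℕ
  out : V × ZMod 4 → Bool
  out_opp : ∀ h, out (opp h) = !out h
  source_target : ∀ v i, out (v, i + 1) = !out (v, i)
  sign : V → VertexSign

namespace CheckerboardDigraph

variable {V : Type*} (G : CheckerboardDigraph V)

/-! ### Edges and Euler circuits -/

/-- The directed edges (those of the vertexless closed curves excepted), each given by its first
half-edge. -/
def Edge : Type _ := {h : V × ZMod 4 // G.out h = true}

variable {G}

/-- The half-edge with which a directed edge starts. -/
def Edge.start (e : G.Edge) : V × ZMod 4 := e.1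

/-- The half-edge with which a directed edge ends. -/
def Edge.finish (e : G.Edge) : V × ZMod 4 := G.opp e.1

/-- The vertex at which a directed edge starts. -/
def Edge.tail (e : G.Edge) : V := e.start.1

/-- The vertex at which a directed edge ends. -/
def Edge.head (e : G.Edge) : V := e.finish.1

variable (G)

/-- The half-edge to which `h` is joined by merging at its vertex. The internal merging joins the
two half-edges at each of the two uncoloured corners, so that the two coloured regions at the
vertex are united and contain the marker; the external merging does the same at the coloured
corners. -/
def partner : Merging → V × ZMod 4 → V × ZMod 4
  | .internal, h => if G.out h then (h.1, h.2 - 1) else (h.1, h.2 + 1)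
  | .external, h => if G.out h then (h.1, h.2 + 1) else (h.1, h.2 - 1)

/-- An Euler circuit, up to the choice of its starting point: a cyclic arrangement of all directed
edges (given by the map `next` to the following edge, which is a single cycle through all edges) in
which every edge starts where the preceding one ends. If there is no edge at all, there is exactly
one, the empty one. -/
structure EulerCircuit where
  next : Equiv.Perm G.Edge
  isCycleOn : next.IsCycleOn Set.univ
  head_eq_tail : ∀ e, e.head = (next e).tail

variable {G}

/-- `v` and `w` interlace in `γ`: starting from some visit of `v`, the circuit meets
`v … w … v … w` before it is back at its starting point. -/
def EulerCircuit.Interlace (γ : G.EulerCircuit) (v w : V) : Prop :=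
  v ≠ w ∧ ∃ (e : G.Edge) (i j k : ℕ), 0 < i ∧ i < j ∧ j < k ∧ k < Nat.card G.Edge ∧
    e.head = v ∧ ((γ.next ^ i) e).head = w ∧ ((γ.next ^ j) e).head = v ∧
    ((γ.next ^ k) e).head = w

/-- `v` is live if it only interlaces vertices with larger labels, and dead otherwise. -/
def EulerCircuit.Live (γ : G.EulerCircuit) (label : V → ℕ) (v : V) : Prop :=
  ∀ w, γ.Interlace v w → label v < label w

/-- `v` is internal to `γ` if, when visiting `v`, the circuit leaves through the half-edges to which
the internal merging joins those of its arrivals; otherwise it is external, and the departures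
are those of the external merging. -/
def EulerCircuit.IsInternal (γ : G.EulerCircuit) (v : V) : Prop :=
  ∀ e : G.Edge, e.head = v → (γ.next e).start = G.partner .internal e.finish

end CheckerboardDigraph

/-! ### Markers, activity letters and weights -/

/-- The labels of markers. -/
inductive MarkerLabel
  | A
  | a
  | B
  | b

/-- The activity letters; `Lbar`, `Dbar`, `lbar`, `dbar` are the overlined letters. -/
inductive ActivityLetter
  | L
  | D
  | l
  | d
  | Lbar
  | Dbar
  | lbar
  | dbar

/-- The label of a marker: `A`, `B` are internal, `a`, `b` external; `A`, `a` belong to positive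
vertices, `B`, `b` to negative ones. -/
def markerLabel : Merging → VertexSign → MarkerLabel
  | .internal, .plus => .A
  | .external, .plus => .a
  | .internal, .minus => .B
  | .external, .minus => .b

/-- The activity letter of a vertex that is live (`true`) or dead (`false`), with given marker. -/
def activityLetter : Bool → MarkerLabel → ActivityLetter
  | true, .A => .L
  | true, .B => .Lbar
  | false, .A => .D
  | false, .B => .Dbar
  | true, .a => .l
  | true, .b => .lbar
  | false, .a => .d
  | false, .b => .dbar

/-- The weight of an activity letter; the indeterminate `q` is `T 1`. -/
noncomputable def ActivityLetter.weight : ActivityLetter → ℤ[T;T⁻¹]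
  | .L => -LaurentPolynomial.T (-3)
  | .D => LaurentPolynomial.T 1
  | .l => -LaurentPolynomial.T 3
  | .d => LaurentPolynomial.T (-1)
  | .Lbar => -LaurentPolynomial.T 3
  | .Dbar => LaurentPolynomial.T (-1)
  | .lbar => -LaurentPolynomial.T (-3)
  | .dbar => LaurentPolynomial.T 1

namespace CheckerboardDigraph

variable {V : Type*} (G : CheckerboardDigraph V)

variable {G} in
open Classical in
/-- The merging performed by `γ` at `v`. -/
noncomputable def EulerCircuit.mergingAt (γ : G.EulerCircuit) (v : V) : Merging :=
  if γ.IsInternal v then .internal else .external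

variable {G} in
open Classical in
/-- The letter of `v` in the activity word of `γ`. -/
noncomputable def EulerCircuit.letter (γ : G.EulerCircuit) (label : V → ℕ) (v : V) :
    ActivityLetter :=
  activityLetter (decide (γ.Live label v)) (markerLabel (γ.mergingAt v) (G.sign v))

variable {G} in
/-- The weight of an Euler circuit: the product of the weights of all vertices. -/
noncomputable def EulerCircuit.weight (γ : G.EulerCircuit) (label : V → ℕ) : ℤ[T;T⁻¹] :=
  ∏ᶠ v : V, (γ.letter label v).weight

/-- The sum of the weights of all Euler circuits. -/
noncomputable def eulerSum (label : V → ℕ) : ℤ[T;T⁻¹] :=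
  ∑ᶠ γ : G.EulerCircuit, γ.weight label

/-! ### Connected components and the polynomial -/

/-- Adjacency of distinct vertices. -/
def graph : SimpleGraph V :=
  SimpleGraph.fromRel fun v w => ∃ i, (G.opp (v, i)).1 = w

theorem opp_mem_supp (c : G.graph.ConnectedComponent) (h : V × ZMod 4) (hh : h.1 ∈ c.supp) :
    (G.opp h).1 ∈ c.supp := by
  by_cases e : (G.opp h).1 = h.1
  · rwa [e]
  · have : G.graph.Adj h.1 (G.opp h).1 := by
      rw [graph, SimpleGraph.fromRel_adj]
      exact ⟨fun h' => e h'.symm, Or.inl ⟨h.2, rfl⟩⟩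
    exact (SimpleGraph.ConnectedComponent.mem_supp_congr_adj c this).1 hh

/-- The component `c`, as a 2-digraph of its own. -/
def component (c : G.graph.ConnectedComponent) : CheckerboardDigraph c.supp where
  opp h := (⟨(G.opp (h.1.1, h.2)).1, G.opp_mem_supp c _ h.1.2⟩, (G.opp (h.1.1, h.2)).2)
  opp_opp h := by
    have := G.opp_opp (h.1.1, h.2)
    ext <;> simp [this]
  opp_ne h h' := by
    apply G.opp_ne (h.1.1, h.2)
    have h1 := congrArg (fun x => x.1.1) h'
    have h2 := congrArg (fun x => x.2) h'
    exact Prod.ext h1 h2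
  circles := 0
  out h := G.out (h.1.1, h.2)
  out_opp h := G.out_opp (h.1.1, h.2)
  source_target v i := G.source_target v.1 i
  sign v := G.sign v.1

/-- The number of connected components, the vertexless closed curves included. -/
noncomputable def numComponents : ℕ :=
  Nat.card G.graph.ConnectedComponent + G.circles

/-- The polynomial `X_G`, computed with the vertices ordered by `label`. The factor of a
vertexless closed curve is its single (empty) Euler circuit's weight `1`. (The truncated
subtraction concerns the empty graph only.) -/
noncomputable def X (label : V → ℕ) : ℤ[T;T⁻¹] :=
  (-(LaurentPolynomial.T 2 + LaurentPolynomial.T (-2))) ^ (G.numComponents - 1) *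
    ∏ᶠ c : G.graph.ConnectedComponent, (G.component c).eulerSum fun v => label v.1

/-! ### Merging at a vertex -/

/-- Having arrived at the vertex of the half-edge `h`, follow the strand of the merging `s` through
that vertex and then the next edge, to the half-edge at its other end. -/
def step (s : Merging) (h : V × ZMod 4) : V × ZMod 4 := G.opp (G.partner s h)

open Classical in
/-- Starting at a half-edge `h` and following strands through `v` as long as we are at `v`: at most
two passages are possible if we come from another vertex. -/
noncomputable def leave (v : V) (s : Merging) (h : V × ZMod 4) : V × ZMod 4 :=
  if h.1 ≠ v then h else if (G.step s h).1 ≠ v then G.step s h else G.step s (G.step s h)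

theorem partner_fst (s : Merging) (h : V × ZMod 4) : (G.partner s h).1 = h.1 := by
  cases s <;> simp only [partner] <;> split_ifs <;> rfl

theorem out_partner (s : Merging) (h : V × ZMod 4) : G.out (G.partner s h) = !G.out h := by
  obtain ⟨v, i⟩ := h
  have h1 := G.source_target v i
  have h2 := G.source_target v (i - 1)
  rw [sub_add_cancel] at h2
  cases s <;> cases h0 : G.out (v, i) <;> simp_all [partner]

theorem partner_partner (s : Merging) (h : V × ZMod 4) : G.partner s (G.partner s h) = h := by
  have h1 := G.out_partner s h
  cases s <;> cases h0 : G.out h <;> simp_all [partner]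

theorem out_step (s : Merging) (h : V × ZMod 4) : G.out (G.step s h) = G.out h := by
  simp [step, out_opp, out_partner]

theorem step_opp_step (s : Merging) (h : V × ZMod 4) : G.step s (G.opp (G.step s h)) = G.opp h := by
  simp [step, opp_opp, partner_partner]

theorem step_injective (s : Merging) : Function.Injective (G.step s) := by
  intro x y hxy
  have := congrArg (fun z => G.partner s (G.opp z)) hxy
  simpa [step, opp_opp, partner_partner] using this

/-- Only two half-edges at a vertex have a given direction. -/
theorem eq_or_eq_of_out {v : V} {x y z : V × ZMod 4} (hx : x.1 = v) (hy : y.1 = v) (hz : z.1 = v)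
    (hxy : G.out x = G.out y) (hxz : G.out x = G.out z) : x = y ∨ x = z ∨ y = z := by
  obtain ⟨x, i⟩ := x
  obtain ⟨y, j⟩ := y
  obtain ⟨z, k⟩ := z
  simp only at hx hy hz
  subst hx hy hz
  have h0 := G.source_target z 0
  have h1 := G.source_target z 1
  have h2 := G.source_target z 2
  simp only [zero_add, one_add_one_eq_two] at h0 h1 h2
  have e3 : (2 + 1 : ZMod 4) = 3 := rfl
  rw [e3] at h2
  simp only [Prod.mk.injEq, true_and]
  have key : ∀ i : ZMod 4, i = 0 ∨ i = 1 ∨ i = 2 ∨ i = 3 := by decide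
  rcases key i with rfl | rfl | rfl | rfl <;> rcases key j with rfl | rfl | rfl | rfl <;>
    rcases key k with rfl | rfl | rfl | rfl <;>
    first
    | exact Or.inl rfl
    | exact Or.inr (Or.inl rfl)
    | exact Or.inr (Or.inr rfl)
    | (exfalso
       cases h : G.out (z, 0) <;> rw [h] at h0 <;> rw [h0] at h1 <;> rw [h1] at h2 <;>
         simp only [h, h0, h1, h2] at hxy hxz <;> contradiction)

theorem leave_fst_ne (v : V) (s : Merging) (h : V × ZMod 4) (hh : h.1 ≠ v) :
    (G.leave v s (G.opp h)).1 ≠ v := by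
  unfold leave
  split_ifs with h1 h2
  · exact h1
  · exact h2
  · push Not at h1 h2
    intro h3
    set a := G.opp h with ha
    have o1 : G.out a = G.out (G.step s a) := (G.out_step s a).symm
    have o2 : G.out a = G.out (G.step s (G.step s a)) := by rw [out_step, out_step]
    -- `a` is reached only from the half-edge whose partner is `h`
    have hne : ∀ x : V × ZMod 4, x.1 = v → G.step s x ≠ a := by
      intro x hx hxa
      have h4 : G.partner s x = h := by
        have := congrArg G.opp hxa
        simpa [step, ha, opp_opp] using this
      apply hh
      rw [← h4, partner_fst, hx]
    rcases G.eq_or_eq_of_out h1 h2 h3 o1 o2 with e | e | e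
    · exact hne a h1 e.symm
    · exact hne _ h2 e.symm
    · exact hne a h1 (G.step_injective s e).symm

theorem out_leave (v : V) (s : Merging) (h : V × ZMod 4) : G.out (G.leave v s h) = G.out h := by
  unfold leave
  split_ifs <;> simp [out_step]

theorem leave_opp_leave (v : V) (s : Merging) (h : V × ZMod 4) (hh : h.1 ≠ v) :
    G.leave v s (G.opp (G.leave v s (G.opp h))) = h := by
  have hp : ∀ x : V × ZMod 4, (G.opp (G.step s x)).1 = x.1 := by
    intro x
    rw [step, opp_opp, partner_fst]
  by_cases h1 : (G.opp h).1 = v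
  · by_cases h2 : (G.step s (G.opp h)).1 = v
    · have e : G.leave v s (G.opp h) = G.step s (G.step s (G.opp h)) := by simp [leave, h1, h2]
      rw [e]
      simp [leave, hp, step_opp_step, opp_opp, h1, h2]
    · have e : G.leave v s (G.opp h) = G.step s (G.opp h) := by simp [leave, h1, h2]
      rw [e]
      simp [leave, hp, step_opp_step, opp_opp, h1, hh]
  · have e : G.leave v s (G.opp h) = G.opp h := by simp [leave, h1]
    rw [e, opp_opp]
    simp [leave, hh]

/-- The vertexless closed curves that arise by the merging `s` at `v`, each given by the set of its
arrivals at `v`. Such a curve passes once (then `C` is a singleton) or twice through the place of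
`v`. -/
def newCircles (v : V) (s : Merging) : Set (Set (V × ZMod 4)) :=
  {C | ∃ h : V × ZMod 4, h.1 = v ∧ G.out h = false ∧ (G.step s h).1 = v ∧
    G.step s (G.step s h) = h ∧ C = {h, G.step s h}}

/-- The 2-digraph obtained by merging at `v`: the vertex `v` is deleted, its edges are joined
according to `s`, and directions (hence the colouring), signs and everything else are kept. -/
noncomputable def merge (v : V) (s : Merging) : CheckerboardDigraph {w : V // w ≠ v} where
  opp h := (⟨(G.leave v s (G.opp (h.1.1, h.2))).1, G.leave_fst_ne v s _ h.1.2⟩,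
    (G.leave v s (G.opp (h.1.1, h.2))).2)
  opp_opp h := by
    have := G.leave_opp_leave v s (h.1.1, h.2) h.1.2
    ext <;> simp [this]
  opp_ne h h' := by
    have h1 := congrArg (fun x => x.1.1) h'
    have h2 := congrArg (fun x => x.2) h'
    have h3 : G.leave v s (G.opp (h.1.1, h.2)) = (h.1.1, h.2) := Prod.ext h1 h2
    have h4 := congrArg G.out h3
    rw [out_leave, out_opp] at h4
    simp at h4
  circles := G.circles + (G.newCircles v s).ncard
  out h := G.out (h.1.1, h.2)
  out_opp h := by
    have : G.out (G.leave v s (G.opp (h.1.1, h.2))) = !G.out (h.1.1, h.2) := by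
      rw [out_leave, out_opp]
    exact this
  source_target w i := G.source_target w.1 i
  sign w := G.sign w.1

end CheckerboardDigraph

/-!
Let `q ^ (±1)` be the weight of a vertex together with a choice of merging at it, and let every
closed curve count `δ = -(q ^ 2 + q ^ (-2))`. A state `s` chooses a merging at every vertex, and
following its strands is a permutation `statePerm s` of the directed edges, whose cycles are the
resulting closed curves. The state sum, in which `s` has the product of the weights of its vertices
times `δ` to the number of cycles, satisfies the asserted recursion for an obvious reason: sort the
states by their merging at `v` (`CheckerboardDigraph.stateSum_eq_add`). Merging at `v` replaces
`statePerm s` by its first return map to the edges that do not start at `v`, so the only cycles lost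
are those which become closed curves without vertex
(`CheckerboardDigraph.numCycles_statePerm_eq_merge`). It remains to see that the polynomial `X`,
whatever the labels, is the state sum up to a factor `δ` (`CheckerboardDigraph.loopValue_mul_X`);
this factor can be cancelled as Laurent polynomials over `ℤ` form a domain.

The state sum is multiplicative over connected components (`CheckerboardDigraph.stateSum_eq_prod`),
so let `G` be connected. Changing the merging at `v` multiplies `statePerm s` by the transposition
of the two edges that end at `v`; hence it joins two cycles into one or splits one into two. Euler
circuits are the states with a single cycle, which by connectedness are the states in which both
passages through every vertex lie in one cycle; and `w` interlaces `v` exactly if changing the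
merging at `v` separates the two passages through `w`
(`Equiv.Perm.not_sameCycle_mul_swap_iff_alternate`).

The activity expansion is carried out one vertex at a time, by increasing label. For a set `L` of
vertices closed under taking smaller labels, consider only the states in which both passages through
every vertex of `L` lie in one cycle, and let activities relative to `L` determine the factors of
the vertices in `L`. Passing from `L` to `L ∪ {m}`, with `m` of larger label, the states whose
passages through `m` lie in different cycles have to disappear. Such a state `s` is absorbed by the
state `s'` with the other merging at `m`: there `m` interlaces nothing in `L`, so it is live, and
all other interlacements agree in `s` and `s'`; moreover `s` has one cycle more than `s'`, and indeed
the weight of a live vertex is the sum of the weight of its merging and `δ` times the weight of the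
other merging (`weight_activityLetter`). All states with `m` dead are unaffected. This is
`StateSystem.activityTerm_insert`; from `L = ∅` to the set of all vertices it turns the state sum
into the sum over Euler circuits.
-/

open Equiv.Perm

/-! ### Cycles of a permutation times a transposition -/

namespace Equiv.Perm

variable {E : Type*}

/-- The number of cycles of a permutation, fixed points included. -/
noncomputable def numCycles (σ : Perm E) : ℕ :=
  Nat.card (Quotient (SameCycle.setoid σ))

theorem SameCycle.rel_of_forall_apply [Finite E] {σ : Perm E} {r : E → E → Prop}
    (hr : Equivalence r) (h : ∀ x, r x (σ x)) {x y : E} (hxy : σ.SameCycle x y) : r x y := by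
  obtain ⟨n, -, rfl⟩ := hxy.exists_pow_eq'
  induction n with
  | zero => exact hr.refl x
  | succ n ih =>
    rw [pow_succ', mul_apply]
    exact hr.trans (ih ⟨n, by simp⟩) (h _)

theorem numCycles_eq_one {σ : Perm E} [Nonempty E] (h : ∀ x y, σ.SameCycle x y) :
    numCycles σ = 1 := by
  rw [numCycles, Nat.card_eq_one_iff_unique]
  refine ⟨⟨fun x y => ?_⟩, ⟨Quotient.mk _ (Classical.arbitrary E)⟩⟩
  induction x using Quotient.inductionOn
  induction y using Quotient.inductionOn
  exact Quotient.sound (h _ _)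

/-- The cycles of a first return map. Here `ι` is the inclusion of the set on which `ρ`, the first
return map of `σ`, is defined. -/
theorem sameCycle_iff_of_firstReturn [Finite E] {F : Type*} [Finite F] {σ : Perm E} {ρ : Perm F} {ι : F → E}
    (hι : Function.Injective ι)
    (h : ∀ f, ∃ k, 0 < k ∧ ι (ρ f) = (σ ^ k) (ι f) ∧
      ∀ j, 0 < j → j < k → (σ ^ j) (ι f) ∉ Set.range ι) (f g : F) :
    ρ.SameCycle f g ↔ σ.SameCycle (ι f) (ι g) := by
  constructor
  · refine SameCycle.rel_of_forall_apply (r := fun f g => σ.SameCycle (ι f) (ι g))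
      ⟨fun _ => SameCycle.refl _ _, fun h => h.symm, fun h h' => h.trans h'⟩ fun f => ?_
    obtain ⟨k, -, hk, -⟩ := h f
    exact ⟨k, by simpa using hk.symm⟩
  · intro hfg
    obtain ⟨n, -, hn⟩ := hfg.exists_pow_eq'
    clear hfg
    induction n using Nat.strong_induction_on generalizing f with
    | _ n ih =>
      rcases Nat.eq_zero_or_pos n with rfl | hn0
      · rw [hι hn]
      · obtain ⟨k, hk0, hk, hlt⟩ := h f
        rcases Nat.lt_or_ge n k with hnk | hnk
        · exact absurd ⟨g, hn.symm⟩ (hlt n hn0 hnk)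
        · refine sameCycle_apply_left.1 (ih (n - k) (by omega) (ρ f) ?_)
          rw [hk, ← mul_apply, ← pow_add, Nat.sub_add_cancel hnk, hn]

theorem numCycles_eq_add_of_firstReturn [Finite E] {F : Type*} [Finite F] {σ : Perm E} {ρ : Perm F}
    {ι : F → E} (hι : Function.Injective ι)
    (h : ∀ f, ∃ k, 0 < k ∧ ι (ρ f) = (σ ^ k) (ι f) ∧
      ∀ j, 0 < j → j < k → (σ ^ j) (ι f) ∉ Set.range ι) :
    numCycles σ = numCycles ρ + Nat.card {q : Quotient (SameCycle.setoid σ) //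
      ∀ e, Quotient.mk _ e = q → e ∉ Set.range ι} := by
  classical
  have hiff := sameCycle_iff_of_firstReturn hι h
  let φ : Quotient (SameCycle.setoid ρ) → {q : Quotient (SameCycle.setoid σ) //
      ¬ ∀ e, Quotient.mk _ e = q → e ∉ Set.range ι} := fun q =>
    ⟨Quotient.map' ι (fun f g hfg => (hiff f g).1 hfg) q, by
      induction q using Quotient.inductionOn with | _ f
      exact fun h => h (ι f) rfl ⟨f, rfl⟩⟩
  have hφ : Function.Bijective φ := by
    constructor
    · intro x y hxy
      induction x using Quotient.inductionOn with | _ x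
      induction y using Quotient.inductionOn with | _ y
      exact Quotient.sound ((hiff x y).2 (Quotient.exact (congrArg Subtype.val hxy)))
    · rintro ⟨q, hq⟩
      push Not at hq
      obtain ⟨_, rfl, f, rfl⟩ := hq
      exact ⟨Quotient.mk _ f, rfl⟩
  rw [numCycles, numCycles, Nat.card_congr (Equiv.ofBijective φ hφ), add_comm, ← Nat.card_sum]
  exact Nat.card_congr (Equiv.sumCompl _).symm

variable [DecidableEq E]

/-- As long as the orbit of `a` avoids `a` and `b`, it is followed by the orbit of `b` under
`σ * swap a b`. -/
theorem mul_swap_pow_apply {σ : Perm E} {a b : E} {n : ℕ} (hn : 0 < n)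
    (h : ∀ i, 0 < i → i < n → (σ ^ i) a ≠ a ∧ (σ ^ i) a ≠ b) :
    ((σ * swap a b) ^ n) b = (σ ^ n) a := by
  induction n, hn using Nat.le_induction with
  | base => simp
  | succ n hn ih =>
    have h1 := h n hn (Nat.lt_succ_self n)
    rw [pow_succ', mul_apply, ih fun i hi hin => h i hi (hin.trans (Nat.lt_succ_self n)),
      mul_apply, swap_apply_of_ne_of_ne h1.1 h1.2, ← mul_apply, ← pow_succ']

variable [Finite E]

theorem sameCycle_mul_swap_of_not_sameCycle {σ : Perm E} {a b : E} (h : ¬ σ.SameCycle a b) :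
    (σ * swap a b).SameCycle a b := by
  classical
  have hex : ∃ n, 0 < n ∧ (σ ^ n) a = a :=
    ⟨orderOf σ, orderOf_pos σ, by rw [pow_orderOf_eq_one, one_apply]⟩
  have hs := Nat.find_spec hex
  have hm : ∀ i, 0 < i → i < Nat.find hex → (σ ^ i) a ≠ a ∧ (σ ^ i) a ≠ b :=
    fun i hi hin => ⟨fun e => Nat.find_min hex hin ⟨hi, e⟩, fun e => h ⟨i, by simpa using e⟩⟩
  have := mul_swap_pow_apply hs.1 hm
  exact SameCycle.symm ⟨Nat.find hex, by rw [zpow_natCast, this, hs.2]⟩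

theorem not_sameCycle_mul_swap_of_sameCycle {σ : Perm E} {a b : E} (hab : a ≠ b)
    (h : σ.SameCycle a b) : ¬ (σ * swap a b).SameCycle a b := by
  classical
  have hex : ∃ n, 0 < n ∧ (σ ^ n) a = b := by
    obtain ⟨n, hn, -, e⟩ := h.exists_pow_eq''
    exact ⟨n, hn, e⟩
  set k := Nat.find hex with hk
  have hs : 0 < k ∧ (σ ^ k) a = b := Nat.find_spec hex
  have hb : ∀ i, 0 < i → i < k → (σ ^ i) a ≠ b :=
    fun i hi hin e => Nat.find_min hex hin ⟨hi, e⟩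
  have hm : ∀ i, 0 < i → i < k → (σ ^ i) a ≠ a ∧ (σ ^ i) a ≠ b := by
    refine fun i hi hin => ⟨fun e => hb (k - i) (by omega) (by omega) ?_, hb i hi hin⟩
    have h1 : (σ ^ (k - i + i)) a = b := by rw [Nat.sub_add_cancel hin.le, hs.2]
    rwa [pow_add, mul_apply, e] at h1
  have hper : ((σ * swap a b) ^ k) b = b := by rw [mul_swap_pow_apply hs.1 hm, hs.2]
  -- the new cycle of `b` has length `k` and consists of `σ a, …, σ ^ k a = b`
  have hne : ∀ n, ((σ * swap a b) ^ n) b ≠ a := by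
    intro n
    induction n using Nat.strong_induction_on with
    | _ n ih =>
      rcases Nat.lt_or_ge n k with hnk | hnk
      · rcases Nat.eq_zero_or_pos n with rfl | hn
        · exact hab.symm
        · rw [mul_swap_pow_apply hn fun i hi hin => hm i hi (hin.trans hnk)]
          exact (hm n hn hnk).1
      · have h1 := ih (n - k) (by omega)
        rwa [← Nat.sub_add_cancel hnk, pow_add, mul_apply, hper]
  intro hc
  obtain ⟨n, -, e⟩ := hc.symm.exists_pow_eq'
  exact hne n e

/-- Multiplying by a transposition of two points in different cycles unites these two cycles. -/
theorem sameCycle_mul_swap_iff {σ : Perm E} {a b : E} (h : ¬ σ.SameCycle a b) (x y : E) :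
    (σ * swap a b).SameCycle x y ↔ σ.SameCycle x y ∨
      (σ.SameCycle x a ∧ σ.SameCycle y b) ∨ (σ.SameCycle x b ∧ σ.SameCycle y a) := by
  have hab := sameCycle_mul_swap_of_not_sameCycle h
  constructor
  · refine SameCycle.rel_of_forall_apply (r := fun x y => σ.SameCycle x y ∨
      (σ.SameCycle x a ∧ σ.SameCycle y b) ∨ (σ.SameCycle x b ∧ σ.SameCycle y a))
      ⟨fun x => Or.inl (SameCycle.refl σ x), ?_, ?_⟩ ?_
    · rintro x y (h1 | ⟨h1, h2⟩ | ⟨h1, h2⟩)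
      · exact Or.inl h1.symm
      · exact Or.inr (Or.inr ⟨h2, h1⟩)
      · exact Or.inr (Or.inl ⟨h2, h1⟩)
    · rintro x y z (h1 | ⟨h1, h2⟩ | ⟨h1, h2⟩) (h3 | ⟨h3, h4⟩ | ⟨h3, h4⟩)
      · exact Or.inl (h1.trans h3)
      · exact Or.inr (Or.inl ⟨h1.trans h3, h4⟩)
      · exact Or.inr (Or.inr ⟨h1.trans h3, h4⟩)
      · exact Or.inr (Or.inl ⟨h1, h3.symm.trans h2⟩)
      · exact Or.inr (Or.inl ⟨h1, h4⟩)
      · exact Or.inl (h1.trans h4.symm)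
      · exact Or.inr (Or.inr ⟨h1, h3.symm.trans h2⟩)
      · exact Or.inl (h1.trans h4.symm)
      · exact Or.inr (Or.inr ⟨h1, h4⟩)
    · intro x
      by_cases hxa : x = a
      · subst hxa
        refine Or.inr (Or.inl ⟨SameCycle.refl σ x, ?_⟩)
        simpa using SameCycle.refl σ b
      · by_cases hxb : x = b
        · subst hxb
          refine Or.inr (Or.inr ⟨SameCycle.refl σ x, ?_⟩)
          simpa using SameCycle.refl σ a
        · rw [mul_apply, swap_apply_of_ne_of_ne hxa hxb]
          exact Or.inl (sameCycle_apply_right.2 (SameCycle.refl σ x))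
  · have hswap : ∀ x, (σ * swap a b).SameCycle x (swap a b x) := by
      intro x
      by_cases hxa : x = a
      · subst hxa
        simpa using hab
      · by_cases hxb : x = b
        · subst hxb
          simpa using hab.symm
        · rw [swap_apply_of_ne_of_ne hxa hxb]
    have hle : ∀ {x y}, σ.SameCycle x y → (σ * swap a b).SameCycle x y := by
      intro x y
      refine SameCycle.rel_of_forall_apply (SameCycle.equivalence (σ * swap a b)) fun x => ?_
      have h1 : (σ * swap a b) (swap a b x) = σ x := by simp
      rw [← h1]
      exact sameCycle_apply_right.2 (hswap x)
    rintro (h1 | ⟨h1, h2⟩ | ⟨h1, h2⟩)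
    · exact hle h1
    · exact (hle h1).trans (hab.trans (hle h2).symm)
    · exact (hle h1).trans (hab.symm.trans (hle h2).symm)

theorem SameCycle.of_mul_swap {σ : Perm E} {a b : E} (h : σ.SameCycle a b) {x y : E}
    (hxy : (σ * swap a b).SameCycle x y) : σ.SameCycle x y := by
  by_cases hab : a = b
  · rwa [hab, swap_self, ← one_def, mul_one] at hxy
  have h1 := sameCycle_mul_swap_iff (not_sameCycle_mul_swap_of_sameCycle hab h) x y
  rw [mul_swap_mul_self] at h1
  exact h1.2 (Or.inl hxy)

theorem numCycles_eq_of_not_sameCycle {σ : Perm E} {a b : E} (h : ¬ σ.SameCycle a b) :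
    numCycles σ = numCycles (σ * swap a b) + 1 := by
  classical
  have hiff := sameCycle_mul_swap_iff h
  let qb : Quotient (SameCycle.setoid σ) := Quotient.mk _ b
  let f : {q : Quotient (SameCycle.setoid σ) // q ≠ qb} →
      Quotient (SameCycle.setoid (σ * swap a b)) := fun q =>
    Quotient.map' id (fun x y hxy => (hiff x y).2 (Or.inl hxy)) q.1
  have hf : Function.Bijective f := by
    constructor
    · rintro ⟨x, hx⟩ ⟨y, hy⟩ hxy
      induction x using Quotient.inductionOn with | _ x
      induction y using Quotient.inductionOn with | _ y
      have h1 : (σ * swap a b).SameCycle x y := Quotient.exact hxy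
      apply Subtype.ext
      rcases (hiff x y).1 h1 with h1 | ⟨-, h1⟩ | ⟨h1, -⟩
      · exact Quotient.sound h1
      · exact absurd (Quotient.sound h1) hy
      · exact absurd (Quotient.sound h1) hx
    · intro y
      induction y using Quotient.inductionOn with | _ y
      by_cases hy : σ.SameCycle y b
      · refine ⟨⟨Quotient.mk _ a, fun e => h (Quotient.exact e)⟩, Quotient.sound ?_⟩
        exact (hiff a y).2 (Or.inr (Or.inl ⟨SameCycle.refl σ a, hy⟩))
      · exact ⟨⟨Quotient.mk _ y, fun e => hy (Quotient.exact e)⟩, rfl⟩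
  rw [numCycles, numCycles, ← Nat.card_congr (Equiv.ofBijective f hf)]
  have := Fintype.ofFinite (Quotient (SameCycle.setoid σ))
  rw [Nat.card_eq_fintype_card, Nat.card_eq_fintype_card, Fintype.card_subtype_compl,
    Fintype.card_subtype_eq]
  have : 0 < Fintype.card (Quotient (SameCycle.setoid σ)) := Fintype.card_pos_iff.2 ⟨qb⟩
  omega

theorem numCycles_mul_swap_of_sameCycle {σ : Perm E} {a b : E} (hab : a ≠ b)
    (h : σ.SameCycle a b) : numCycles (σ * swap a b) = numCycles σ + 1 := by
  rw [numCycles_eq_of_not_sameCycle (not_sameCycle_mul_swap_of_sameCycle hab h),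
    mul_swap_mul_self]

/-- In a single cycle, the visits `c`, `d` lie in different cycles after multiplication by
`swap a b` exactly if they separate `a` and `b`. -/
theorem not_sameCycle_mul_swap_iff_alternate {σ : Perm E} (hσ : σ.IsCycleOn _root_.Set.univ)
    {a b c d : E} (hab : a ≠ b) (hca : c ≠ a) (hcb : c ≠ b) (hda : d ≠ a) (hdb : d ≠ b) :
    ¬ (σ * swap a b).SameCycle c d ↔ ∃ (e : E) (i j k : ℕ), 0 < i ∧ i < j ∧ j < k ∧
      k < Nat.card E ∧ (e = a ∨ e = b) ∧ ((σ ^ i) e = c ∨ (σ ^ i) e = d) ∧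
      ((σ ^ j) e = a ∨ (σ ^ j) e = b) ∧ ((σ ^ k) e = c ∨ (σ ^ k) e = d) := by
  have := Fintype.ofFinite E
  have hσ' : σ.IsCycleOn ((Finset.univ : Finset E) : Set E) := by simpa using hσ
  have hN : (Finset.univ : Finset E).card = Nat.card E := by simp
  set N := Nat.card E with hNdef
  have hinj : ∀ {x : E} {i j : ℕ}, i < j → j < N → (σ ^ i) x ≠ (σ ^ j) x := by
    intro x i j hij hj h
    have h1 := (hσ'.pow_apply_eq_pow_apply (Finset.mem_univ x)).1 h
    rw [hN] at h1
    have := Nat.ModEq.eq_of_lt_of_lt h1 (hij.trans hj) hj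
    omega
  have hper : ∀ x, (σ ^ N) x = x := by
    intro x
    rw [hσ'.pow_apply_eq (Finset.mem_univ x), hN]
  -- the arcs from `x` to `σ ^ j x` and back give the two new cycles
  have harc1 : ∀ {x : E} {i j : ℕ}, 0 < i → i < j → j < N →
      (σ * swap x ((σ ^ j) x)).SameCycle ((σ ^ j) x) ((σ ^ i) x) := by
    intro x i j hi hij hj
    refine ⟨i, ?_⟩
    rw [zpow_natCast, mul_swap_pow_apply hi]
    exact fun l hl hli => ⟨(hinj (i := 0) hl (by omega)).symm, hinj (by omega) hj⟩
  have harc2 : ∀ {x : E} {k j : ℕ}, j < k → k < N →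
      (σ * swap x ((σ ^ j) x)).SameCycle x ((σ ^ k) x) := by
    intro x k j hjk hk
    refine ⟨(k - j : ℕ), ?_⟩
    rw [zpow_natCast, swap_comm, mul_swap_pow_apply (by omega)]
    · rw [← mul_apply, ← pow_add, Nat.sub_add_cancel hjk.le]
    · intro l hl hli
      rw [← mul_apply, ← pow_add]
      exact ⟨(hinj (by omega) (by omega)).symm, (hinj (i := 0) (by omega) (by omega)).symm⟩
  constructor
  · intro h
    obtain ⟨j, hj, rfl⟩ := hσ'.exists_pow_eq (Finset.mem_univ a) (Finset.mem_univ b)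
    obtain ⟨p, hp, rfl⟩ := hσ'.exists_pow_eq (Finset.mem_univ a) (Finset.mem_univ c)
    obtain ⟨r, hr, rfl⟩ := hσ'.exists_pow_eq (Finset.mem_univ a) (Finset.mem_univ d)
    rw [hN] at hj hp hr
    have hp0 : 0 < p := by
      rcases Nat.eq_zero_or_pos p with rfl | h0
      · exact absurd rfl hca
      · exact h0
    have hr0 : 0 < r := by
      rcases Nat.eq_zero_or_pos r with rfl | h0
      · exact absurd rfl hda
      · exact h0
    have hpj : p ≠ j := fun e => hcb (by rw [e])
    have hrj : r ≠ j := fun e => hdb (by rw [e])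
    rcases Nat.lt_or_gt_of_ne hpj with h1 | h1 <;> rcases Nat.lt_or_gt_of_ne hrj with h2 | h2
    · exact absurd ((harc1 hp0 h1 hj).symm.trans (harc1 hr0 h2 hj)) h
    · exact ⟨a, p, j, r, hp0, h1, h2, hr, by simp⟩
    · exact ⟨a, r, j, p, hr0, h2, h1, hp, by simp⟩
    · exact absurd ((harc2 h1 hp).symm.trans (harc2 h2 hr)) h
  · rintro ⟨e, i, j, k, hi, hij, hjk, hk, he, hie, hje, hke⟩
    have hjne : (σ ^ j) e ≠ e := (hinj (i := 0) (by omega) (by omega)).symm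
    have hikne : (σ ^ i) e ≠ (σ ^ k) e := hinj (by omega) hk
    have hsw : swap a b = swap e ((σ ^ j) e) := by
      rcases he with rfl | rfl <;> rcases hje with h1 | h1
      · exact absurd h1 hjne
      · rw [h1]
      · rw [h1, swap_comm]
      · exact absurd h1 hjne
    have hnot : ¬ (σ * swap e ((σ ^ j) e)).SameCycle e ((σ ^ j) e) :=
      not_sameCycle_mul_swap_of_sameCycle hjne.symm (hσ.2 (Set.mem_univ _) (Set.mem_univ _))
    have h1 := harc1 (x := e) hi hij (hjk.trans hk)
    have h2 := harc2 (x := e) hjk hk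
    have key : ¬ (σ * swap e ((σ ^ j) e)).SameCycle ((σ ^ i) e) ((σ ^ k) e) :=
      fun h3 => hnot (h2.trans (h3.symm.trans h1.symm))
    rw [hsw]
    rcases hie with h3 | h3 <;> rcases hke with h4 | h4
    · exact absurd (h3.trans h4.symm) hikne
    · rwa [← h3, ← h4]
    · rw [← h3, ← h4]
      exact fun h5 => key h5.symm
    · exact absurd (h3.trans h4.symm) hikne

end Equiv.Perm

/-! ### The activity expansion of a state sum -/

/-- The other merging. -/
def Merging.flip : Merging → Merging
  | .internal => .external
  | .external => .internal

@[simp]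
theorem Merging.flip_flip (t : Merging) : t.flip.flip = t := by
  cases t <;> rfl

instance : Fintype Merging where
  elems := ⟨{.internal, .external}, by simp⟩
  complete t := by cases t <;> simp

section Activity

variable {V E : Type*} [DecidableEq V] [DecidableEq E]

/-- Change the merging at one vertex. -/
def flipAt (v : V) (s : V → Merging) : V → Merging :=
  Function.update s v (s v).flip

@[simp]
theorem flipAt_same (v : V) (s : V → Merging) : flipAt v s v = (s v).flip := by
  simp [flipAt]

theorem flipAt_of_ne {v w : V} (h : w ≠ v) (s : V → Merging) : flipAt v s w = s w := by
  simp [flipAt, h]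

theorem flipAt_involutive (v : V) : Function.Involutive (flipAt v) := by
  intro s
  ext w
  by_cases h : w = v
  · subst h; simp
  · rw [flipAt_of_ne h, flipAt_of_ne h]

theorem flipAt_comm (v w : V) (s : V → Merging) :
    flipAt v (flipAt w s) = flipAt w (flipAt v s) := by
  by_cases h : v = w
  · rw [h]
  · ext u
    by_cases hv : u = v
    · subst hv
      rw [flipAt_same, flipAt_of_ne h, flipAt_of_ne h, flipAt_same]
    · by_cases hw : u = w
      · subst hw
        rw [flipAt_same, flipAt_of_ne hv, flipAt_of_ne hv, flipAt_same]
      · rw [flipAt_of_ne hv, flipAt_of_ne hw, flipAt_of_ne hw, flipAt_of_ne hv]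

/-- A family of permutations, indexed by the states `s : V → Merging`, in which changing the state
at `v` amounts to multiplication by the transposition of `a v` and `b v`. -/
structure StateSystem (V E : Type*) [DecidableEq V] [DecidableEq E] where
  perm : (V → Merging) → Equiv.Perm E
  a : V → E
  b : V → E
  a_ne_b : ∀ v, a v ≠ b v
  perm_flipAt : ∀ v s, perm (flipAt v s) = perm s * Equiv.swap (a v) (b v)

namespace StateSystem

variable (S : StateSystem V E)

/-- The two passages through `v` belong to the same cycle. -/
def Joined (s : V → Merging) (v : V) : Prop :=
  (S.perm s).SameCycle (S.a v) (S.b v)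

/-- Interlacement of `v` and `w` with respect to a state in which both are joined: splitting the
cycle at `v` separates the two passages through `w`. -/
def Interlace (s : V → Merging) (v w : V) : Prop :=
  v ≠ w ∧ ¬ S.Joined (flipAt v s) w

variable {S}

theorem joined_flipAt_iff [Finite E] {s : V → Merging} {v : V} :
    S.Joined (flipAt v s) v ↔ ¬ S.Joined s v := by
  unfold Joined
  rw [S.perm_flipAt]
  exact ⟨fun h h' => not_sameCycle_mul_swap_of_sameCycle (S.a_ne_b v) h' h,
    sameCycle_mul_swap_of_not_sameCycle⟩

/-- Splitting at a vertex refines the cycles. -/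
theorem Joined.sameCycle_of_flipAt [Finite E] {s : V → Merging} {v : V} (h : S.Joined s v) {x y : E}
    (hxy : (S.perm (flipAt v s)).SameCycle x y) : (S.perm s).SameCycle x y := by
  rw [S.perm_flipAt] at hxy
  exact SameCycle.of_mul_swap h hxy

theorem Joined.numCycles_flipAt [Finite E] {s : V → Merging} {v : V} (h : S.Joined s v) :
    numCycles (S.perm (flipAt v s)) = numCycles (S.perm s) + 1 := by
  rw [S.perm_flipAt]
  exact numCycles_mul_swap_of_sameCycle (S.a_ne_b v) h

/-- If the strands at `m` lie in different cycles, reconnecting them there does not affect the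
interlacement of other vertices. -/
theorem interlace_flipAt_iff [Finite E] {s : V → Merging} {m v w : V} (hm : ¬ S.Joined s m)
    (hv : S.Joined s v) (hw : S.Joined s w) :
    S.Interlace (flipAt m s) v w ↔ S.Interlace s v w := by
  have hm' : ¬ S.Joined (flipAt v s) m := fun h => hm (hv.sameCycle_of_flipAt h)
  refine and_congr Iff.rfl (not_congr ?_)
  rw [flipAt_comm]
  have h1 := sameCycle_mul_swap_iff hm' (S.a w) (S.b w)
  rw [← S.perm_flipAt] at h1
  refine h1.trans ⟨?_, Or.inl⟩
  rintro (h | ⟨h2, h3⟩ | ⟨h2, h3⟩)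
  · exact h
  · exact absurd ((hv.sameCycle_of_flipAt h2).symm.trans
      (hw.trans (hv.sameCycle_of_flipAt h3))) hm
  · exact absurd ((hv.sameCycle_of_flipAt h3).symm.trans
      (hw.symm.trans (hv.sameCycle_of_flipAt h2))) hm

variable (S)

/-- `v` is live relative to `L` if it interlaces only those vertices of `L` that have larger
labels. -/
def LiveIn (label : V → ℕ) (L : Finset V) (s : V → Merging) (v : V) : Prop :=
  ∀ w ∈ L, S.Interlace s v w → label v < label w

variable {R : Type*} [CommRing R] (x : V → Merging → R) (δ : R)

open Classical in
/-- The contribution of `v` to the weight of a state: on `L`, live vertices count for both of their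
mergings, the other one splitting off a cycle. -/
noncomputable def activityFactor (label : V → ℕ) (L : Finset V) (s : V → Merging) (v : V) : R :=
  if v ∈ L ∧ S.LiveIn label L s v then x v (s v) + x v (s v).flip * δ else x v (s v)

open Classical in
/-- The weight of a state when the activity expansion has been carried out at the vertices
of `L`. -/
noncomputable def activityTerm [Fintype V] (label : V → ℕ) (L : Finset V) (s : V → Merging) : R :=
  if ∀ v ∈ L, S.Joined s v then
    (∏ v, S.activityFactor x δ label L s v) * δ ^ numCycles (S.perm s) else 0

variable {S x δ}

theorem activityFactor_of_notMem {label : V → ℕ} {L : Finset V} {s : V → Merging} {v : V}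
    (hv : v ∉ L) : S.activityFactor x δ label L s v = x v (s v) := by
  rw [activityFactor, if_neg fun h => hv h.1]

theorem activityFactor_insert_of_ne {label : V → ℕ} {L : Finset V} {s : V → Merging} {m v : V}
    (hlt : ∀ w ∈ L, label w < label m) (hvm : v ≠ m) :
    S.activityFactor x δ label (insert m L) s v = S.activityFactor x δ label L s v := by
  classical
  unfold activityFactor
  refine if_congr ?_ rfl rfl
  rw [Finset.mem_insert, or_iff_right hvm]
  refine and_congr_right fun hv => ?_
  simp only [LiveIn, Finset.forall_mem_insert]
  exact and_iff_right fun _ => hlt v hv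

theorem activityFactor_flipAt [Finite E] {label : V → ℕ} {L : Finset V} {s : V → Merging} {m v : V}
    (hm : ¬ S.Joined s m) (hL : ∀ w ∈ L, S.Joined s w) (hvm : v ≠ m) :
    S.activityFactor x δ label L (flipAt m s) v = S.activityFactor x δ label L s v := by
  classical
  unfold activityFactor
  rw [flipAt_of_ne hvm]
  refine if_congr (and_congr_right fun hv => ?_) rfl rfl
  exact forall₂_congr fun w hw => imp_congr_left (interlace_flipAt_iff hm (hL v hv) (hL w hw))

/-- The heart of the activity expansion: a state in which the strands at `m` lie in different
cycles is absorbed by the state with the other merging at `m`, where `m` is then live. -/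
theorem activityTerm_insert [Finite E] [Fintype V] {label : V → ℕ} {L : Finset V} {m : V}
    (hlt : ∀ w ∈ L, label w < label m) {s : V → Merging} (hm : S.Joined s m) :
    S.activityTerm x δ label (insert m L) s =
      S.activityTerm x δ label L s + S.activityTerm x δ label L (flipAt m s) := by
  have hmL : m ∉ L := fun h => lt_irrefl _ (hlt m h)
  have hm' : ¬ S.Joined (flipAt m s) m := fun h => joined_flipAt_iff.1 h hm
  unfold activityTerm
  by_cases hL : ∀ v ∈ L, S.Joined s v
  · have hprod : ∀ (L' : Finset V) (s' : V → Merging),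
        ∏ v, S.activityFactor x δ label L' s' v = S.activityFactor x δ label L' s' m *
          ∏ v ∈ Finset.univ.erase m, S.activityFactor x δ label L' s' v :=
      fun L' s' => (Finset.mul_prod_erase _ _ (Finset.mem_univ m)).symm
    have h1 : ∏ v ∈ Finset.univ.erase m, S.activityFactor x δ label (insert m L) s v =
        ∏ v ∈ Finset.univ.erase m, S.activityFactor x δ label L s v :=
      Finset.prod_congr rfl fun v hv =>
        activityFactor_insert_of_ne hlt (Finset.ne_of_mem_erase hv)
    rw [if_pos (Finset.forall_mem_insert _ _ _ |>.2 ⟨hm, hL⟩), if_pos hL, hprod, hprod, hprod L,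
      h1, activityFactor_of_notMem hmL, activityFactor_of_notMem hmL, flipAt_same]
    -- as `m` has the largest label, it is live exactly if it interlaces nothing in `L`
    have hlive : S.LiveIn label (insert m L) s m ↔ ∀ w ∈ L, S.Joined (flipAt m s) w := by
      simp only [LiveIn, Finset.forall_mem_insert, Interlace]
      refine ⟨fun h w hw => ?_, fun h => ⟨fun h' => absurd rfl h'.1, fun w hw h' => ?_⟩⟩
      · by_contra h'
        have h2 := h.2 w hw ⟨fun e => hmL (e ▸ hw), h'⟩
        exact lt_asymm h2 (hlt w hw)
      · exact absurd (h w hw) h'.2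
    by_cases hL' : ∀ w ∈ L, S.Joined (flipAt m s) w
    · have h2 : ∏ v ∈ Finset.univ.erase m, S.activityFactor x δ label L (flipAt m s) v =
          ∏ v ∈ Finset.univ.erase m, S.activityFactor x δ label L s v := by
        refine Finset.prod_congr rfl fun v hv => ?_
        have h3 := activityFactor_flipAt (x := x) (δ := δ) (label := label) hm' hL'
          (Finset.ne_of_mem_erase hv)
        rw [flipAt_involutive m s] at h3
        exact h3.symm
      rw [if_pos hL', h2, hm.numCycles_flipAt, activityFactor,
        if_pos ⟨Finset.mem_insert_self m L, hlive.2 hL'⟩, pow_succ]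
      ring
    · rw [if_neg hL', activityFactor, if_neg fun h => hL' (hlive.1 h.2), add_zero]
  · rw [if_neg fun h => hL fun v hv => h v (Finset.mem_insert_of_mem hv), if_neg hL,
      if_neg fun h => hL fun v hv => hm.sameCycle_of_flipAt (h v hv), add_zero]

theorem activityTerm_insert_of_not_joined [Fintype V] {label : V → ℕ} {L : Finset V} {m : V}
    {s : V → Merging} (hm : ¬ S.Joined s m) : S.activityTerm x δ label (insert m L) s = 0 :=
  if_neg fun h => hm (h m (Finset.mem_insert_self m L))

theorem sum_activityTerm_insert [Finite E] [Fintype V] {label : V → ℕ} {L : Finset V} {m : V}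
    (hlt : ∀ w ∈ L, label w < label m) :
    ∑ s, S.activityTerm x δ label (insert m L) s = ∑ s, S.activityTerm x δ label L s := by
  classical
  have h1 : ∀ s, S.activityTerm x δ label (insert m L) s =
      (if S.Joined s m then S.activityTerm x δ label L s else 0) +
        if S.Joined (flipAt m s) m then 0 else S.activityTerm x δ label L (flipAt m s) := by
    intro s
    by_cases hm : S.Joined s m
    · rw [activityTerm_insert hlt hm, if_pos hm, if_neg fun h => joined_flipAt_iff.1 h hm]
    · rw [activityTerm_insert_of_not_joined hm, if_neg hm,
        if_pos (joined_flipAt_iff.2 hm), add_zero]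
  have h2 := Equiv.sum_comp (flipAt_involutive m).toPerm
    fun s => if S.Joined s m then 0 else S.activityTerm x δ label L s
  rw [Finset.sum_congr rfl fun s _ => h1 s, Finset.sum_add_distrib]
  refine (congrArg (_ + ·) h2).trans ?_
  rw [← Finset.sum_add_distrib]
  refine Finset.sum_congr rfl fun s _ => ?_
  by_cases hm : S.Joined s m <;> simp [hm]

/-- The state sum equals its activity expansion. -/
theorem sum_activityTerm_univ [Finite E] [Fintype V] {label : V → ℕ} (hlabel : Function.Injective label) :
    ∑ s, S.activityTerm x δ label Finset.univ s =
      ∑ s, (∏ v, x v (s v)) * δ ^ numCycles (S.perm s) := by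
  have key : ∀ L : Finset V, ∑ s, S.activityTerm x δ label L s =
      ∑ s, (∏ v, x v (s v)) * δ ^ numCycles (S.perm s) := by
    intro L
    induction L using Finset.induction_on_max_value label with
    | empty => simp [activityTerm, activityFactor_of_notMem]
    | insert m L hm hle ih =>
      rw [sum_activityTerm_insert, ih]
      exact fun w hw => lt_of_le_of_ne (hle w hw) fun e => hm (hlabel e ▸ hw)
  exact key _

end StateSystem

end Activity

/-! ### The state sum of a 2-digraph -/

/-- The factor contributed to the state sum by a vertex of the given sign and merging. -/
noncomputable def mergingWeight : VertexSign → Merging → ℤ[T;T⁻¹]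
  | .plus, .internal => LaurentPolynomial.T 1
  | .plus, .external => LaurentPolynomial.T (-1)
  | .minus, .internal => LaurentPolynomial.T (-1)
  | .minus, .external => LaurentPolynomial.T 1

/-- The value of a closed curve. -/
noncomputable def loopValue : ℤ[T;T⁻¹] :=
  -(LaurentPolynomial.T 2 + LaurentPolynomial.T (-2))

/-- The weight of a live vertex is the sum over both of its mergings, the one which is not performed
by the circuit splitting off a closed curve. -/
theorem weight_activityLetter (ε : VertexSign) (t : Merging) (live : Bool) :
    (activityLetter live (markerLabel t ε)).weight =
      if live then mergingWeight ε t + mergingWeight ε t.flip * loopValue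
      else mergingWeight ε t := by
  have h1 : (LaurentPolynomial.T 1 + LaurentPolynomial.T (-1) * loopValue : ℤ[T;T⁻¹]) =
      -LaurentPolynomial.T (-3) := by
    rw [loopValue, mul_neg, mul_add, ← LaurentPolynomial.T_add, ← LaurentPolynomial.T_add]
    norm_num
  have h2 : (LaurentPolynomial.T (-1) + LaurentPolynomial.T 1 * loopValue : ℤ[T;T⁻¹]) =
      -LaurentPolynomial.T 3 := by
    rw [loopValue, mul_neg, mul_add, ← LaurentPolynomial.T_add, ← LaurentPolynomial.T_add]
    norm_num
  cases live
  · cases ε <;> cases t <;> rfl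
  · cases ε <;> cases t
    · exact h1.symm
    · exact h2.symm
    · exact h2.symm
    · exact h1.symm

namespace CheckerboardDigraph

variable {V : Type*} {G : CheckerboardDigraph V}

theorem Edge.out_finish (e : G.Edge) : G.out e.finish = false := by
  have h : G.out e.1 = true := e.2
  rw [finish, G.out_opp, h, Bool.not_true]

theorem Edge.ext_start {e f : G.Edge} (h : e.start = f.start) : e = f :=
  Subtype.ext h

theorem Edge.ext_finish {e f : G.Edge} (h : e.finish = f.finish) : e = f := by
  apply Edge.ext_start
  have := congrArg G.opp h
  rwa [finish, finish, G.opp_opp, G.opp_opp] at this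

variable (G) in
/-- The directed edge that ends with a given incoming half-edge. -/
def edgeTo (h : V × ZMod 4) (hh : G.out h = false) : G.Edge :=
  ⟨G.opp h, by rw [G.out_opp, hh, Bool.not_false]⟩

@[simp]
theorem finish_edgeTo (h : V × ZMod 4) (hh : G.out h = false) : (G.edgeTo h hh).finish = h :=
  G.opp_opp h

noncomputable instance : DecidableEq G.Edge :=
  Classical.decEq _

instance [Finite V] : Finite G.Edge :=
  inferInstanceAs (Finite {h : V × ZMod 4 // G.out h = true})

variable (G)

theorem partner_internal_ne_partner_external (h : V × ZMod 4) :
    G.partner .internal h ≠ G.partner .external h := by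
  have h1 : ∀ i : ZMod 4, i - 1 ≠ i + 1 := by decide
  simp only [partner]
  split_ifs
  · exact fun e => h1 _ (congrArg Prod.snd e)
  · exact fun e => h1 _ (congrArg Prod.snd e).symm

/-- The half-edges at a vertex whose direction differs from that of `h` are the partners of `h`. -/
theorem eq_partner_or {h h' : V × ZMod 4} (h1 : h'.1 = h.1) (h2 : G.out h' = !G.out h) :
    h' = G.partner .internal h ∨ h' = G.partner .external h := by
  rcases G.eq_or_eq_of_out (v := h.1) (x := h') h1 (G.partner_fst .internal h)
    (G.partner_fst .external h) (by rw [h2, out_partner]) (by rw [h2, out_partner])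
    with e | e | e
  · exact Or.inl e
  · exact Or.inr e
  · exact absurd e (G.partner_internal_ne_partner_external h)

theorem partner_flip_partner (t : Merging) (h : V × ZMod 4) :
    G.partner t (G.partner t.flip h) ≠ h := by
  intro e
  have h1 := congrArg (G.partner t) e
  rw [partner_partner] at h1
  cases t
  · exact G.partner_internal_ne_partner_external h h1.symm
  · exact G.partner_internal_ne_partner_external h h1

/-- Exactly two edges end at a vertex. -/
theorem exists_edges_to (v : V) :
    ∃ p : G.Edge × G.Edge, p.1 ≠ p.2 ∧ ∀ e : G.Edge, e.head = v ↔ e = p.1 ∨ e = p.2 := by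
  obtain ⟨h, hv, hh⟩ : ∃ h : V × ZMod 4, h.1 = v ∧ G.out h = false := by
    cases h0 : G.out (v, 0)
    · exact ⟨(v, 0), rfl, h0⟩
    · exact ⟨(v, 0 + 1), rfl, by rw [G.source_target, h0, Bool.not_true]⟩
  have hh' : G.out (G.partner .internal (G.partner .external h)) = false := by
    rw [out_partner, out_partner, hh]; rfl
  have hv' : (G.partner .internal (G.partner .external h)).1 = v := by
    rw [partner_fst, partner_fst, hv]
  have hne := G.partner_flip_partner .internal h
  refine ⟨(G.edgeTo h hh, G.edgeTo _ hh'), fun e => hne ?_, fun e => ⟨fun he => ?_, ?_⟩⟩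
  · have := congrArg Edge.finish e
    rw [finish_edgeTo, finish_edgeTo] at this
    exact this.symm
  · rcases G.eq_or_eq_of_out (v := v) he hv hv' (by rw [e.out_finish, hh])
      (by rw [e.out_finish, hh']) with h1 | h1 | h1
    · exact Or.inl (Edge.ext_finish (by rw [h1, finish_edgeTo]))
    · exact Or.inr (Edge.ext_finish (by rw [h1, finish_edgeTo]))
    · exact absurd h1.symm hne
  · rintro (rfl | rfl)
    · rw [Edge.head, finish_edgeTo, hv]
    · rw [Edge.head, finish_edgeTo, hv']

/-- The permutation of the edges obtained by following the strands of the mergings `s`. -/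
def statePerm (s : V → Merging) : Equiv.Perm G.Edge where
  toFun e := ⟨G.partner (s e.head) e.finish, by rw [out_partner, e.out_finish, Bool.not_false]⟩
  invFun e := G.edgeTo (G.partner (s e.tail) e.start) (by
    have h : G.out e.start = true := e.2
    rw [out_partner, h, Bool.not_true])
  left_inv e := by
    apply Edge.ext_finish
    simp [Edge.tail, Edge.start, partner_fst, Edge.head, partner_partner]
  right_inv e := by
    apply Edge.ext_start
    simp [Edge.tail, Edge.start, partner_fst, Edge.head, partner_partner]

variable {G}

theorem start_statePerm (s : V → Merging) (e : G.Edge) :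
    (G.statePerm s e).start = G.partner (s e.head) e.finish :=
  rfl

theorem tail_statePerm (s : V → Merging) (e : G.Edge) : (G.statePerm s e).tail = e.head := by
  rw [Edge.tail, start_statePerm, partner_fst, Edge.head]

theorem finish_statePerm (s : V → Merging) (e : G.Edge) :
    (G.statePerm s e).finish = G.step (s e.head) e.finish :=
  rfl

variable (G)

theorem statePerm_flipAt [DecidableEq V] {v : V} {a b : G.Edge} (hab : a ≠ b)
    (h : ∀ e : G.Edge, e.head = v ↔ e = a ∨ e = b) (s : V → Merging) :
    G.statePerm (flipAt v s) = G.statePerm s * Equiv.swap a b := by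
  have key : ∀ {a b : G.Edge}, a ≠ b → a.head = v → b.head = v →
      G.statePerm (flipAt v s) a = G.statePerm s b := by
    intro a b hab ha hb
    apply Edge.ext_start
    rw [start_statePerm, start_statePerm, ha, hb, flipAt_same]
    have ha' : a.finish.1 = v := ha
    have hb' : b.finish.1 = v := hb
    rcases G.eq_or_eq_of_out (v := v) (x := G.partner (s v).flip a.finish)
      (y := G.partner (s v) a.finish) (z := G.partner (s v) b.finish)
      (by rw [partner_fst, ha']) (by rw [partner_fst, ha']) (by rw [partner_fst, hb'])
      (by simp [out_partner]) (by simp [out_partner, Edge.out_finish]) with e | e | e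
    · refine absurd ?_ (G.partner_flip_partner (s v) a.finish)
      rw [e, partner_partner]
    · exact e
    · refine absurd (Edge.ext_finish ?_) hab
      have := congrArg (G.partner (s v)) e
      rwa [partner_partner, partner_partner] at this
  ext1 e
  rw [Equiv.Perm.mul_apply]
  have ha := (h a).2 (Or.inl rfl)
  have hb := (h b).2 (Or.inr rfl)
  by_cases hea : e = a
  · rw [hea, Equiv.swap_apply_left, key hab ha hb]
  · by_cases heb : e = b
    · rw [heb, Equiv.swap_apply_right, key hab.symm hb ha]
    · rw [Equiv.swap_apply_of_ne_of_ne hea heb]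
      have hev : e.head ≠ v := fun e' => ((h e).1 e').elim hea heb
      apply Edge.ext_start
      rw [start_statePerm, start_statePerm, flipAt_of_ne hev]

/-- The state permutations, with the pairs of edges that end at the same vertex. -/
noncomputable def stateSystem [DecidableEq V] : StateSystem V G.Edge where
  perm := G.statePerm
  a v := (G.exists_edges_to v).choose.1
  b v := (G.exists_edges_to v).choose.2
  a_ne_b v := (G.exists_edges_to v).choose_spec.1
  perm_flipAt v s := G.statePerm_flipAt (G.exists_edges_to v).choose_spec.1
    (G.exists_edges_to v).choose_spec.2 s

variable {G}

theorem head_eq_iff [DecidableEq V] (e : G.Edge) (v : V) :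
    e.head = v ↔ e = G.stateSystem.a v ∨ e = G.stateSystem.b v :=
  (G.exists_edges_to v).choose_spec.2 e

theorem head_a [DecidableEq V] (v : V) : (G.stateSystem.a v).head = v :=
  (head_eq_iff _ v).2 (Or.inl rfl)

theorem head_b [DecidableEq V] (v : V) : (G.stateSystem.b v).head = v :=
  (head_eq_iff _ v).2 (Or.inr rfl)

variable (G) in
/-- The state sum: every closed curve contributes `-(q ^ 2 + q ^ (-2))`. -/
noncomputable def stateSum : ℤ[T;T⁻¹] :=
  ∑ᶠ s : V → Merging, (∏ᶠ v, mergingWeight (G.sign v) (s v)) *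
    loopValue ^ numCycles (G.statePerm s)

/-! ### Euler circuits as states with a single cycle -/

theorem EulerCircuit.ext_next {γ γ' : G.EulerCircuit} (h : γ.next = γ'.next) : γ = γ' := by
  cases γ; cases γ'; cases h; rfl

theorem mergingAt_eq_of_next_eq {γ : G.EulerCircuit} {s : V → Merging}
    (h : γ.next = G.statePerm s) : γ.mergingAt = s := by
  classical
  funext v
  have h1 : γ.IsInternal v ↔ s v = .internal := by
    constructor
    · intro h2
      have h3 := h2 (G.stateSystem.a v) (head_a v)
      rw [h, start_statePerm, head_a] at h3
      cases h4 : s v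
      · rfl
      · rw [h4] at h3
        exact absurd h3.symm (G.partner_internal_ne_partner_external _)
    · intro h2 e he
      rw [h, start_statePerm, he, h2]
  unfold EulerCircuit.mergingAt
  cases h2 : s v
  · rw [if_pos (h1.2 h2)]
  · rw [if_neg fun h3 => Merging.noConfusion ((h1.1 h3).symm.trans h2)]

theorem next_eq_statePerm (γ : G.EulerCircuit) : γ.next = G.statePerm γ.mergingAt := by
  classical
  ext1 e
  apply Edge.ext_start
  rw [start_statePerm]
  have hor : ∀ f : G.Edge, (γ.next f).start = G.partner .internal f.finish ∨
      (γ.next f).start = G.partner .external f.finish := by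
    intro f
    have h1 : (γ.next f).start.1 = f.finish.1 := (γ.head_eq_tail f).symm
    have h2 : G.out (γ.next f).start = true := (γ.next f).2
    exact G.eq_partner_or h1 (by rw [h2, f.out_finish, Bool.not_false])
  unfold EulerCircuit.mergingAt
  split_ifs with h
  · exact h e rfl
  · unfold EulerCircuit.IsInternal at h
    push Not at h
    obtain ⟨f, hf, hne⟩ := h
    have hext := (hor f).resolve_left hne
    by_cases hef : e = f
    · rw [hef, hext]
    · -- both departures cannot use the same half-edge
      have h1 : (γ.next e).start ≠ (γ.next f).start := fun e' =>
        hef (γ.next.injective (Edge.ext_start e'))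
      have he1 : (γ.next e).start.1 = e.head := (γ.head_eq_tail e).symm
      have hf1 : f.finish.1 = e.head := hf
      have he2 : G.out (γ.next e).start = true := (γ.next e).2
      rcases G.eq_or_eq_of_out (v := e.head) he1 (y := G.partner .external f.finish)
        (z := G.partner .external e.finish) (by rw [partner_fst, hf1])
        (by rw [partner_fst]; rfl) (by rw [he2, out_partner, f.out_finish]; rfl)
        (by rw [he2, out_partner, e.out_finish]; rfl) with h2 | h2 | h2
      · exact absurd (h2.trans hext.symm) h1
      · exact h2
      · have h3 := congrArg (G.partner .external) h2
        rw [partner_partner, partner_partner] at h3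
        exact absurd (Edge.ext_finish h3).symm hef

variable (G) in
/-- Euler circuits correspond to the states that have a single cycle. -/
noncomputable def eulerCircuitEquiv :
    G.EulerCircuit ≃ {s : V → Merging // (G.statePerm s).IsCycleOn Set.univ} where
  toFun γ := ⟨γ.mergingAt, by rw [← next_eq_statePerm]; exact γ.isCycleOn⟩
  invFun s := ⟨G.statePerm s.1, s.2, fun e => (tail_statePerm s.1 e).symm⟩
  left_inv γ := EulerCircuit.ext_next (next_eq_statePerm γ).symm
  right_inv s := Subtype.ext (mergingAt_eq_of_next_eq rfl)

theorem interlace_iff [DecidableEq V] [Finite V] (γ : G.EulerCircuit) (v w : V) :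
    γ.Interlace v w ↔ G.stateSystem.Interlace γ.mergingAt v w := by
  refine and_congr_right fun hvw => ?_
  have hne : ∀ {e f : G.Edge}, e.head = w → f.head = v → e ≠ f :=
    fun he hf h => hvw (by rw [← hf, ← h, he])
  rw [StateSystem.Joined, G.stateSystem.perm_flipAt]
  have hγ : G.stateSystem.perm γ.mergingAt = γ.next := (next_eq_statePerm γ).symm
  rw [hγ, not_sameCycle_mul_swap_iff_alternate γ.isCycleOn (G.stateSystem.a_ne_b v)
    (hne (head_a w) (head_a v)) (hne (head_a w) (head_b v)) (hne (head_b w) (head_a v))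
    (hne (head_b w) (head_b v))]
  simp only [head_eq_iff]

/-- In a connected 2-digraph, the states in which both passages through every vertex belong to the
same cycle have a single cycle. -/
theorem isCycleOn_iff_forall_joined [DecidableEq V] [Finite V] (hG : G.graph.Preconnected) (s : V → Merging) :
    (G.statePerm s).IsCycleOn Set.univ ↔ ∀ v, G.stateSystem.Joined s v := by
  refine ⟨fun h v => h.2 (Set.mem_univ _) (Set.mem_univ _), fun h => ?_⟩
  refine ⟨Set.bijOn_univ.2 (G.statePerm s).bijective, fun e _ f _ => ?_⟩
  have hv : ∀ e f : G.Edge, e.head = f.head → (G.statePerm s).SameCycle e f := by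
    intro e f hef
    have hj : (G.statePerm s).SameCycle (G.stateSystem.a f.head) (G.stateSystem.b f.head) :=
      h f.head
    rcases (head_eq_iff e _).1 hef with h1 | h1 <;>
      rcases (head_eq_iff f _).1 rfl with h2 | h2 <;> rw [h1] <;> nth_rw 2 [h2]
    · exact hj
    · exact hj.symm
  have htail : ∀ e f : G.Edge, e.head = f.tail → (G.statePerm s).SameCycle e f := by
    intro e f hef
    have h1 : ((G.statePerm s).symm f).head = f.tail := by
      rw [← tail_statePerm s, Equiv.apply_symm_apply]
    have h2 := hv e _ (hef.trans h1.symm)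
    have h3 := sameCycle_apply_right.2 h2
    rwa [Equiv.apply_symm_apply] at h3
  have hopp : ∀ (x : V × ZMod 4) (e f : G.Edge), e.head = x.1 → f.head = (G.opp x).1 →
      (G.statePerm s).SameCycle e f := by
    intro x e f he hf
    cases hx : G.out x
    · have hg : (G.edgeTo x hx).tail = (G.opp x).1 := rfl
      exact (hv e (G.edgeTo x hx) (by rw [he, Edge.head, finish_edgeTo])).trans
        (htail f _ (hf.trans hg.symm)).symm
    · let g : G.Edge := ⟨x, hx⟩
      exact (htail e g he).trans (hv g f hf.symm)
  have hreach : ∀ w, Relation.ReflTransGen G.graph.Adj e.head w → ∀ f : G.Edge, f.head = w →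
      (G.statePerm s).SameCycle e f := by
    intro w hw
    induction hw with
    | refl => exact fun f hf => hv e f hf.symm
    | @tail u w _ huw ih =>
      intro f hf
      refine (ih _ (head_a u)).trans ?_
      rw [graph, SimpleGraph.fromRel_adj] at huw
      rcases huw.2 with ⟨i, hi⟩ | ⟨i, hi⟩
      · exact hopp (u, i) _ f (head_a u) (hf.trans hi.symm)
      · exact (hopp (w, i) f _ hf ((head_a u).trans hi.symm)).symm
  exact hreach _ ((SimpleGraph.reachable_iff_reflTransGen _ _).1 (hG e.head f.head)) f rfl

theorem weight_eq_prod_activityFactor [DecidableEq V] [Fintype V] (γ : G.EulerCircuit) (label : V → ℕ) :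
    γ.weight label = ∏ v, G.stateSystem.activityFactor (fun v => mergingWeight (G.sign v))
      loopValue label Finset.univ γ.mergingAt v := by
  classical
  rw [EulerCircuit.weight, finprod_eq_prod_of_fintype]
  refine Finset.prod_congr rfl fun v _ => ?_
  have h1 : γ.Live label v ↔ G.stateSystem.LiveIn label Finset.univ γ.mergingAt v := by
    simp only [EulerCircuit.Live, StateSystem.LiveIn, interlace_iff, Finset.mem_univ,
      true_imp_iff]
  rw [EulerCircuit.letter, weight_activityLetter, StateSystem.activityFactor]
  by_cases h : γ.Live label v
  · rw [if_pos (decide_eq_true h), if_pos ⟨Finset.mem_univ v, h1.1 h⟩]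
  · rw [decide_eq_false h, if_neg Bool.false_ne_true, if_neg fun h' => h (h1.2 h'.2)]

/-- For a connected 2-digraph, the sum over all Euler circuits is the activity expansion of the
state sum. -/
theorem loopValue_mul_eulerSum [Finite V] [Nonempty V]
    (hG : G.graph.Preconnected) {label : V → ℕ} (hlabel : Function.Injective label) :
    loopValue * G.eulerSum label = G.stateSum := by
  classical
  have := Fintype.ofFinite V
  have hE : Nonempty G.Edge := ⟨G.stateSystem.a (Classical.arbitrary V)⟩
  have key := G.stateSystem.sum_activityTerm_univ
    (x := fun v => mergingWeight (G.sign v)) (δ := loopValue) hlabel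
  have h2 := finsum_eq_of_bijective
    (g := fun s : {s : V → Merging // (G.statePerm s).IsCycleOn Set.univ} =>
      ∏ v, G.stateSystem.activityFactor (fun v => mergingWeight (G.sign v))
        loopValue label Finset.univ s.1 v)
    G.eulerCircuitEquiv G.eulerCircuitEquiv.bijective
    fun γ => weight_eq_prod_activityFactor γ label
  rw [eulerSum, h2,
    finsum_eq_sum_of_fintype, Finset.mul_sum, stateSum, finsum_eq_sum_of_fintype]
  simp only [finprod_eq_prod_of_fintype]
  refine Eq.trans ?_ key
  have h3 : ∀ s : V → Merging, ¬ (G.statePerm s).IsCycleOn Set.univ →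
      G.stateSystem.activityTerm (fun v => mergingWeight (G.sign v)) loopValue label
        Finset.univ s = 0 := by
    intro s hs
    rw [StateSystem.activityTerm, if_neg]
    exact fun h => hs ((isCycleOn_iff_forall_joined hG s).2 fun v => h v (Finset.mem_univ v))
  have h4 : ∀ s ∈ Finset.univ, G.stateSystem.activityTerm
      (fun v => mergingWeight (G.sign v)) loopValue label Finset.univ s ≠ 0 →
        (G.statePerm s).IsCycleOn Set.univ :=
    fun s _ h => by_contra fun h' => h (h3 s h')
  rw [← Finset.sum_filter_of_ne h4, Finset.sum_subtype (Finset.univ.filter _)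
    (p := fun s => (G.statePerm s).IsCycleOn Set.univ) (by simp)]
  refine Finset.sum_congr rfl fun s _ => ?_
  rw [StateSystem.activityTerm,
    if_pos fun v _ => (isCycleOn_iff_forall_joined hG s.1).1 s.2 v, mul_comm]
  congr 1
  have h5 : numCycles (G.statePerm s.1) = 1 :=
    numCycles_eq_one fun e f => s.2.2 (Set.mem_univ e) (Set.mem_univ f)
  change loopValue = loopValue ^ numCycles (G.statePerm s.1)
  rw [h5, pow_one]

end CheckerboardDigraph

namespace CheckerboardDigraph

variable {V : Type*} {G : CheckerboardDigraph V}

/-! ### Decomposition into connected components -/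

theorem component_preconnected (c : G.graph.ConnectedComponent) :
    (G.component c).graph.Preconnected := by
  have h : (G.component c).graph = c.toSimpleGraph := by
    ext v w
    have h1 : c.toSimpleGraph.Adj v w ↔ G.graph.Adj v.1 w.1 := Iff.rfl
    rw [h1]
    refine (SimpleGraph.fromRel_adj _ v w).trans
      (Iff.trans ?_ (SimpleGraph.fromRel_adj _ v.1 w.1).symm)
    simp only [ne_eq, Subtype.ext_iff]
    rfl
  rw [h]
  exact c.connected_toSimpleGraph.preconnected

/-- The edges of a component, as edges of the whole 2-digraph. -/
def Edge.ofComponent {c : G.graph.ConnectedComponent} (e : (G.component c).Edge) : G.Edge :=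
  ⟨(e.1.1.1, e.1.2), e.2⟩

theorem Edge.ofComponent_injective (c : G.graph.ConnectedComponent) :
    Function.Injective (Edge.ofComponent : (G.component c).Edge → G.Edge) := by
  intro e f h
  have h1 := congrArg Edge.start h
  have h2 := congrArg Prod.fst h1
  have h3 := congrArg Prod.snd h1
  exact Edge.ext_start (Prod.ext (Subtype.ext h2) h3)

theorem ofComponent_statePerm (c : G.graph.ConnectedComponent) (s : V → Merging)
    (e : (G.component c).Edge) :
    ((G.component c).statePerm (fun v => s v.1) e).ofComponent =
      G.statePerm s e.ofComponent := by
  apply Edge.ext_start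
  have h : ∀ (t : Merging) (h : c.supp × ZMod 4),
      (((G.component c).partner t h).1.1, ((G.component c).partner t h).2) =
        G.partner t (h.1.1, h.2) := by
    intro t h
    cases t <;> cases hh : G.out (h.1.1, h.2) <;> simp [partner, component, hh]
  exact h (s e.head.1) e.finish

theorem component_tail_eq_of_sameCycle [Finite V] {s : V → Merging} {e f : G.Edge}
    (h : (G.statePerm s).SameCycle e f) :
    G.graph.connectedComponentMk e.tail = G.graph.connectedComponentMk f.tail := by
  refine SameCycle.rel_of_forall_apply
    (r := fun e f : G.Edge => G.graph.connectedComponentMk e.tail =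
      G.graph.connectedComponentMk f.tail)
    ⟨fun _ => rfl, fun h => h.symm, fun h h' => h.trans h'⟩ (fun e => ?_) h
  rw [tail_statePerm]
  exact (G.opp_mem_supp (G.graph.connectedComponentMk e.tail) e.start rfl).symm

theorem numCycles_statePerm_eq_sum [Finite V] [Fintype G.graph.ConnectedComponent]
    (s : V → Merging) :
    numCycles (G.statePerm s) =
      ∑ c, numCycles ((G.component c).statePerm fun v => s v.1) := by
  have hiff : ∀ (c : G.graph.ConnectedComponent) (e f : (G.component c).Edge),
      ((G.component c).statePerm fun v => s v.1).SameCycle e f ↔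
        (G.statePerm s).SameCycle e.ofComponent f.ofComponent := fun c =>
    sameCycle_iff_of_firstReturn (Edge.ofComponent_injective c) fun e =>
      ⟨1, Nat.one_pos, by rw [pow_one, ofComponent_statePerm], fun j h0 h1 => by omega⟩
  let φ : (Σ c, Quotient (SameCycle.setoid ((G.component c).statePerm fun v => s v.1))) →
      Quotient (SameCycle.setoid (G.statePerm s)) := fun q =>
    Quotient.map' Edge.ofComponent (fun e f h => (hiff q.1 e f).1 h) q.2
  have hφ : Function.Bijective φ := by
    constructor
    · rintro ⟨c, q⟩ ⟨d, r⟩ h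
      induction q using Quotient.inductionOn with | _ e
      induction r using Quotient.inductionOn with | _ f
      have h1 : (G.statePerm s).SameCycle e.ofComponent f.ofComponent := Quotient.exact h
      have h2 : c = d := by
        have h3 : G.graph.connectedComponentMk e.tail.1 = c := e.tail.2
        have h4 : G.graph.connectedComponentMk f.tail.1 = d := f.tail.2
        rw [← h3, ← h4]
        exact component_tail_eq_of_sameCycle h1
      subst h2
      rw [Quotient.sound ((hiff c e f).2 h1)]
    · intro q
      induction q using Quotient.inductionOn with | _ e
      exact ⟨⟨G.graph.connectedComponentMk e.tail,
        Quotient.mk _ ⟨(⟨e.1.1, rfl⟩, e.1.2), e.2⟩⟩, rfl⟩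
  rw [numCycles, ← Nat.card_congr (Equiv.ofBijective φ hφ), Nat.card_sigma]
  rfl

theorem stateSum_eq_prod [Finite V] [Fintype G.graph.ConnectedComponent] :
    G.stateSum = ∏ c, (G.component c).stateSum := by
  classical
  have := Fintype.ofFinite V
  have h1 : ∀ c : G.graph.ConnectedComponent, (G.component c).stateSum =
      ∑ s : c.supp → Merging, (∏ v : c.supp, mergingWeight (G.sign v.1) (s v)) *
        loopValue ^ numCycles ((G.component c).statePerm s) := by
    intro c
    rw [stateSum, finsum_eq_sum_of_fintype]
    simp only [finprod_eq_prod_of_fintype]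
    rfl
  rw [Finset.prod_congr rfl fun c _ => h1 c, Finset.prod_univ_sum, Fintype.piFinset_univ,
    stateSum, finsum_eq_sum_of_fintype]
  simp only [finprod_eq_prod_of_fintype]
  let φ : (V → Merging) → ((c : G.graph.ConnectedComponent) → c.supp → Merging) :=
    fun s c v => s v.1
  have hφ : Function.Bijective φ := by
    constructor
    · intro s t h
      funext v
      exact congrFun (congrFun h (G.graph.connectedComponentMk v)) ⟨v, rfl⟩
    · intro t
      refine ⟨fun v => t (G.graph.connectedComponentMk v) ⟨v, rfl⟩, ?_⟩
      funext c v
      obtain ⟨v, rfl⟩ := v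
      rfl
  refine Fintype.sum_bijective φ hφ _ _ fun s => ?_
  rw [Finset.prod_mul_distrib, Finset.prod_pow_eq_pow_sum, numCycles_statePerm_eq_sum]
  congr 1
  refine (Fintype.prod_fiberwise G.graph.connectedComponentMk
    fun v => mergingWeight (G.sign v) (s v)).symm.trans (Finset.prod_congr rfl fun c _ => ?_)
  exact Finset.prod_equiv (Equiv.refl _) (fun _ => by simp) fun _ _ => rfl

/-- Up to one factor, the polynomial is the state sum, and thus does not depend on the labels. -/
theorem loopValue_mul_X [Finite V] {label : V → ℕ} (hlabel : Function.Injective label)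
    (hG : 0 < G.numComponents) : loopValue * G.X label = loopValue ^ G.circles * G.stateSum := by
  have := Fintype.ofFinite G.graph.ConnectedComponent
  have h1 : ∀ c : G.graph.ConnectedComponent,
      loopValue * (G.component c).eulerSum (fun v => label v.1) = (G.component c).stateSum := by
    intro c
    have : Nonempty c.supp := c.nonempty_supp.to_subtype
    exact loopValue_mul_eulerSum (component_preconnected c)
      (hlabel.comp Subtype.val_injective)
  have h2 : G.X label = loopValue ^ (G.numComponents - 1) *
    ∏ᶠ c : G.graph.ConnectedComponent, (G.component c).eulerSum fun v => label v.1 := rfl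
  rw [h2, ← mul_assoc, ← pow_succ', Nat.sub_add_cancel hG, numComponents, add_comm, pow_add,
    stateSum_eq_prod, ← Finset.prod_congr rfl fun c _ => h1 c, Finset.prod_mul_distrib,
    finprod_eq_prod_of_fintype, Finset.prod_const, Finset.card_univ, Nat.card_eq_fintype_card,
    mul_assoc]

end CheckerboardDigraph

namespace CheckerboardDigraph

variable {V : Type*} {G : CheckerboardDigraph V}

/-! ### Merging at a vertex -/

/-- The edge of `G` with which an edge of the merged 2-digraph starts. -/
def Edge.ofMerge {v : V} {t : Merging} (e : (G.merge v t).Edge) : G.Edge :=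
  ⟨(e.1.1.1, e.1.2), e.2⟩

theorem Edge.ofMerge_injective (v : V) (t : Merging) :
    Function.Injective (Edge.ofMerge : (G.merge v t).Edge → G.Edge) := by
  intro e f h
  have h1 := congrArg Edge.start h
  have h2 := congrArg Prod.fst h1
  have h3 := congrArg Prod.snd h1
  exact Edge.ext_start (Prod.ext (Subtype.ext h2) h3)

theorem mem_range_ofMerge (v : V) (t : Merging) (e : G.Edge) :
    e ∈ Set.range (Edge.ofMerge : (G.merge v t).Edge → G.Edge) ↔ e.tail ≠ v := by
  constructor
  · rintro ⟨f, rfl⟩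
    exact f.1.1.2
  · intro h
    exact ⟨⟨(⟨e.1.1, h⟩, e.1.2), e.2⟩, rfl⟩

theorem start_ofMerge_statePerm (v : V) (s : V → Merging) (e : (G.merge v (s v)).Edge) :
    ((G.merge v (s v)).statePerm (fun w => s w.1) e).ofMerge.start =
      G.partner (s (G.leave v (s v) e.ofMerge.finish).1) (G.leave v (s v) e.ofMerge.finish) := by
  have h : ∀ (t : Merging) (h : {w : V // w ≠ v} × ZMod 4),
      (((G.merge v (s v)).partner t h).1.1, ((G.merge v (s v)).partner t h).2) =
        G.partner t (h.1.1, h.2) := by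
    intro t h
    cases t <;> cases hh : G.out (h.1.1, h.2) <;> simp [partner, merge, hh]
  exact h (s e.head.1) e.finish

/-- Following strands in the merged 2-digraph is the first return, to the edges that do not start
at `v`, of following strands in `G`. -/
theorem exists_pow_eq_ofMerge_statePerm (v : V) (s : V → Merging)
    (e : (G.merge v (s v)).Edge) :
    ∃ k, 0 < k ∧ ((G.merge v (s v)).statePerm (fun w => s w.1) e).ofMerge =
        (G.statePerm s ^ k) e.ofMerge ∧
      ∀ j, 0 < j → j < k → (G.statePerm s ^ j) e.ofMerge ∉
        Set.range (Edge.ofMerge : (G.merge v (s v)).Edge → G.Edge) := by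
  have hstart := start_ofMerge_statePerm v s e
  set f := e.ofMerge
  have hfin : ∀ f : G.Edge, f.head = v → (G.statePerm s f).finish = G.step (s v) f.finish := by
    intro f hf
    rw [finish_statePerm, hf]
  have htail : ∀ f : G.Edge, f.head = v → G.statePerm s f ∉
      Set.range (Edge.ofMerge : (G.merge v (s v)).Edge → G.Edge) := by
    intro f hf
    rw [mem_range_ofMerge, tail_statePerm, hf]
    exact not_not_intro rfl
  unfold leave at hstart
  by_cases h1 : f.head = v
  · have h1' : ¬ f.finish.1 ≠ v := not_not_intro h1
    rw [if_neg h1', ← hfin f h1] at hstart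
    by_cases h2 : (G.statePerm s f).head = v
    · have h2' : ¬ (G.statePerm s f).finish.1 ≠ v := not_not_intro h2
      rw [if_neg h2', ← hfin _ h2] at hstart
      refine ⟨3, by omega, Edge.ext_start hstart, fun j h0 h3 => ?_⟩
      obtain rfl | rfl : j = 1 ∨ j = 2 := by omega
      · exact htail f h1
      · exact htail _ h2
    · have h2' : (G.statePerm s f).finish.1 ≠ v := h2
      rw [if_pos h2'] at hstart
      refine ⟨2, by omega, Edge.ext_start hstart, fun j h0 h3 => ?_⟩
      obtain rfl : j = 1 := by omega
      exact htail f h1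
  · have h1' : f.finish.1 ≠ v := h1
    rw [if_pos h1'] at hstart
    exact ⟨1, by omega, Edge.ext_start hstart, fun j h0 h3 => by omega⟩

/-- The cycles all of whose edges start at `v` are the closed curves without vertex that arise by
merging at `v`. -/
theorem card_cycles_at_eq_ncard_newCircles [Finite V] (v : V) (s : V → Merging) :
    Nat.card {q : Quotient (SameCycle.setoid (G.statePerm s)) //
      ∀ e, Quotient.mk _ e = q →
        e ∉ Set.range (Edge.ofMerge : (G.merge v (s v)).Edge → G.Edge)} =
      (G.newCircles v (s v)).ncard := by
  simp only [mem_range_ofMerge, ne_eq, not_not]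
  have hfin : ∀ f : G.Edge, f.head = v → (G.statePerm s f).finish = G.step (s v) f.finish := by
    intro f hf
    rw [finish_statePerm, hf]
  have hclass : ∀ e : G.Edge, G.statePerm s (G.statePerm s e) = e → ∀ f,
      (G.statePerm s).SameCycle e f → f = e ∨ f = G.statePerm s e := by
    intro e he f hf
    obtain ⟨n, -, rfl⟩ := hf.exists_pow_eq'
    clear hf
    induction n with
    | zero => exact Or.inl rfl
    | succ n ih =>
      rw [pow_succ', Equiv.Perm.mul_apply]
      rcases ih with h | h
      · exact Or.inr (by rw [h])
      · exact Or.inl (by rw [h, he])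
  have himage : ∀ e : G.Edge, e.head = v → G.statePerm s (G.statePerm s e) = e →
      Edge.finish '' {f | Quotient.mk (SameCycle.setoid (G.statePerm s)) f = Quotient.mk _ e} =
        {e.finish, G.step (s v) e.finish} := by
    intro e hev he
    ext h
    constructor
    · rintro ⟨f, hf, rfl⟩
      have hf' : (G.statePerm s).SameCycle f e := Quotient.exact hf
      rcases hclass e he f hf'.symm with rfl | rfl
      · exact Or.inl rfl
      · exact Or.inr (hfin e hev)
    · rintro (rfl | rfl)
      · exact ⟨e, rfl, rfl⟩
      · refine ⟨G.statePerm s e, Quotient.sound ?_, hfin e hev⟩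
        exact sameCycle_apply_left.2 (SameCycle.refl _ e)
  let Ψ : {q : Quotient (SameCycle.setoid (G.statePerm s)) //
      ∀ e : G.Edge, Quotient.mk _ e = q → e.tail = v} → Set (V × ZMod 4) := fun q =>
    Edge.finish '' {f | Quotient.mk (SameCycle.setoid (G.statePerm s)) f = q.1}
  have hΨ : Function.Injective Ψ := by
    rintro ⟨q, hq⟩ ⟨r, hr⟩ h
    induction q using Quotient.inductionOn with | _ e
    have h1 : e.finish ∈ Ψ ⟨Quotient.mk _ e, hq⟩ := ⟨e, rfl, rfl⟩
    rw [h] at h1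
    obtain ⟨f, hf, hfe⟩ := h1
    rw [Edge.ext_finish hfe] at hf
    exact Subtype.ext hf
  have hrange : Set.range Ψ = G.newCircles v (s v) := by
    ext C
    constructor
    · rintro ⟨⟨q, hq⟩, rfl⟩
      induction q using Quotient.inductionOn with | _ e
      have hmem : ∀ f, (G.statePerm s).SameCycle f e → f.head = v := by
        intro f hf
        rw [← tail_statePerm s]
        exact hq _ (Quotient.sound (sameCycle_apply_left.2 hf))
      have h0 : e.head = v := hmem e (SameCycle.refl _ e)
      have h1 : (G.statePerm s e).head = v :=
        hmem _ (sameCycle_apply_left.2 (SameCycle.refl _ e))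
      have h2 : (G.statePerm s (G.statePerm s e)).head = v :=
        hmem _ (sameCycle_apply_left.2 (sameCycle_apply_left.2 (SameCycle.refl _ e)))
      have h3 : G.statePerm s (G.statePerm s e) = e := by
        rcases G.eq_or_eq_of_out (v := v) (x := e.finish) (y := (G.statePerm s e).finish)
          (z := (G.statePerm s (G.statePerm s e)).finish) h0 h1 h2
          (by rw [Edge.out_finish, Edge.out_finish])
          (by rw [Edge.out_finish, Edge.out_finish]) with h | h | h
        · have h4 := Edge.ext_finish h
          rw [← h4, ← h4]
        · exact (Edge.ext_finish h).symm
        · have h4 := (G.statePerm s).injective (Edge.ext_finish h)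
          rw [← h4, ← h4]
      refine ⟨e.finish, h0, e.out_finish, ?_, ?_, himage e h0 h3⟩
      · rw [← hfin e h0]
        exact h1
      · rw [← hfin e h0, ← hfin _ h1, h3]
    · rintro ⟨h, hv, hout, hv', hh, rfl⟩
      have h0 : (G.edgeTo h hout).head = v := by rw [Edge.head, finish_edgeTo, hv]
      have h1 : (G.statePerm s (G.edgeTo h hout)).head = v := by
        rw [Edge.head, hfin _ h0, finish_edgeTo, hv']
      have h2 : G.statePerm s (G.statePerm s (G.edgeTo h hout)) = G.edgeTo h hout := by
        apply Edge.ext_finish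
        rw [hfin _ h1, hfin _ h0, finish_edgeTo, hh]
      refine ⟨⟨Quotient.mk _ (G.edgeTo h hout), fun f hf => ?_⟩, ?_⟩
      · have hf' : (G.statePerm s).SameCycle f (G.edgeTo h hout) := Quotient.exact hf
        rcases hclass _ h2 f hf'.symm with rfl | rfl
        · rw [← h2, tail_statePerm, h1]
        · rw [tail_statePerm, h0]
      · exact (himage _ h0 h2).trans (by rw [finish_edgeTo])
  rw [← hrange, ← Nat.card_coe_set_eq]
  exact Nat.card_congr (Equiv.ofInjective Ψ hΨ)

theorem numCycles_statePerm_eq_merge [Finite V] (v : V) (s : V → Merging) :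
    numCycles (G.statePerm s) =
      numCycles ((G.merge v (s v)).statePerm fun w => s w.1) + (G.newCircles v (s v)).ncard := by
  rw [numCycles_eq_add_of_firstReturn (Edge.ofMerge_injective v (s v))
    (exists_pow_eq_ofMerge_statePerm v s), card_cycles_at_eq_ncard_newCircles]

/-- The state sum is expanded at `v` by sorting the states by their merging at `v`. -/
theorem stateSum_eq_add [Finite V] (v : V) :
    G.stateSum =
      mergingWeight (G.sign v) .internal * (loopValue ^ (G.newCircles v .internal).ncard *
        (G.merge v .internal).stateSum) +
      mergingWeight (G.sign v) .external * (loopValue ^ (G.newCircles v .external).ncard *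
        (G.merge v .external).stateSum) := by
  classical
  have := Fintype.ofFinite V
  have h1 : ∀ t : Merging, (G.merge v t).stateSum =
      ∑ s : {w : V // w ≠ v} → Merging, (∏ w : {w : V // w ≠ v},
        mergingWeight (G.sign w.1) (s w)) * loopValue ^ numCycles ((G.merge v t).statePerm s) := by
    intro t
    rw [stateSum, finsum_eq_sum_of_fintype]
    simp only [finprod_eq_prod_of_fintype]
    rfl
  have h2 : G.stateSum = ∑ t : Merging, mergingWeight (G.sign v) t *
      (loopValue ^ (G.newCircles v t).ncard * (G.merge v t).stateSum) := by
    rw [stateSum, finsum_eq_sum_of_fintype]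
    simp only [finprod_eq_prod_of_fintype, h1, Finset.mul_sum]
    rw [← Fintype.sum_prod_type']
    refine Fintype.sum_equiv (Equiv.funSplitAt v Merging) _ _ fun s => ?_
    rw [numCycles_statePerm_eq_merge v s, pow_add, Fintype.prod_eq_mul_prod_subtype_ne _ v]
    change _ = mergingWeight (G.sign v) (s v) * (loopValue ^ (G.newCircles v (s v)).ncard *
      ((∏ w : {w : V // w ≠ v}, mergingWeight (G.sign w.1) (s w.1)) *
        loopValue ^ numCycles ((G.merge v (s v)).statePerm fun w => s w.1)))
    ring
  rw [h2]
  change (Multiset.map _ {Merging.internal, Merging.external}).sum = _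
  simp

theorem numComponents_pos_of_nonempty [Finite V] [Nonempty V] : 0 < G.numComponents := by
  have : Nonempty G.graph.ConnectedComponent :=
    ⟨G.graph.connectedComponentMk (Classical.arbitrary V)⟩
  exact Nat.add_pos_left Nat.card_pos _

/-- Merging at a vertex leaves at least one component, if only a closed curve without vertex. -/
theorem numComponents_merge_pos [Finite V] (v : V) (t : Merging) :
    0 < (G.merge v t).numComponents := by
  classical
  rcases isEmpty_or_nonempty {w : V // w ≠ v} with h | h
  · refine Nat.add_pos_right _ (Nat.add_pos_right _ ?_)
    let s : V → Merging := fun _ => t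
    have h1 := numCycles_statePerm_eq_merge (G := G) v s
    have h2 : IsEmpty (G.merge v (s v)).Edge := ⟨fun e => h.false e.1.1⟩
    have h3 : numCycles ((G.merge v (s v)).statePerm fun w => s w.1) = 0 :=
      Nat.card_eq_zero.2 (Or.inl ⟨fun q => by
        induction q using Quotient.inductionOn with | _ e
        exact h2.false e⟩)
    have h4 : 0 < numCycles (G.statePerm s) :=
      have : Nonempty (Quotient (SameCycle.setoid (G.statePerm s))) :=
        ⟨Quotient.mk _ (G.stateSystem.a v)⟩
      Nat.card_pos
    rw [h3, zero_add] at h1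
    rwa [h1] at h4
  · exact numComponents_pos_of_nonempty

end CheckerboardDigraph

theorem loopValue_ne_zero : loopValue ≠ 0 := by
  intro h
  have h1 := congrArg (LaurentPolynomial.eval₂ (Int.castRingHom ℚ) (Units.mk0 2 two_ne_zero)) h
  simp [loopValue] at h1
  norm_num at h1

/-- The expansion of the polynomial at a vertex, for both signs at once. -/
theorem CheckerboardDigraph.X_eq_add_merge {V : Type*} [Finite V] (G : CheckerboardDigraph V)
    (v : V) {label : V → ℕ} (hlabel : Function.Injective label)
    {label₀ label₁ : {w : V // w ≠ v} → ℕ}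
    (hlabel₀ : Function.Injective label₀) (hlabel₁ : Function.Injective label₁) :
    G.X label = mergingWeight (G.sign v) .internal * (G.merge v .internal).X label₀ +
      mergingWeight (G.sign v) .external * (G.merge v .external).X label₁ := by
  have : Nonempty V := ⟨v⟩
  have hc : ∀ t, (G.merge v t).circles = G.circles + (G.newCircles v t).ncard := fun t => rfl
  apply mul_left_cancel₀ loopValue_ne_zero
  rw [mul_add, mul_left_comm, mul_left_comm loopValue,
    loopValue_mul_X hlabel numComponents_pos_of_nonempty,
    loopValue_mul_X hlabel₀ (numComponents_merge_pos v _),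
    loopValue_mul_X hlabel₁ (numComponents_merge_pos v _), stateSum_eq_add v, hc, hc, pow_add,
    pow_add]
  ring

theorem theorem3p3 {V : Type*} [Finite V] (G : CheckerboardDigraph V) (v : V)
    (label : V → ℕ) (hlabel : Function.Injective label)
    (label₀ label₁ : {w : V // w ≠ v} → ℕ)
    (hlabel₀ : Function.Injective label₀) (hlabel₁ : Function.Injective label₁) :
    (G.sign v = VertexSign.plus →
      G.X label =
        LaurentPolynomial.T 1 * (G.merge v Merging.internal).X label₀ +
          LaurentPolynomial.T (-1) * (G.merge v Merging.external).X label₁) ∧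
    (G.sign v = VertexSign.minus →
      G.X label =
        LaurentPolynomial.T (-1) * (G.merge v Merging.internal).X label₀ +
          LaurentPolynomial.T 1 * (G.merge v Merging.external).X label₁) := by
  have key := G.X_eq_add_merge v hlabel hlabel₀ hlabel₁
  refine ⟨fun h => ?_, fun h => ?_⟩ <;> rwa [h] at key
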